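/- Let $n\ge 0$ be an integer, $p>n+1$ a prime, and $K$ a finite extension of $\mathbb{Q}_p$ with the absolute value extending $|\cdot|_p$ (and $v_p(p)=1$). In $GL_n(\mathbb{Z}_p)$ let $B$ be the subgroup of matrices that are lower triangular modulo $p$, $G\subset B$ the pro-$p$ Iwahori subgroup of matrices that are lower unipotent modulo $p$, $P^+$ the upper triangular matrices, $U$ the lower unipotent matrices, and $W$ the group of $n\times n$ permutation matrices. Let $\chi(t_1,\dots,t_n)=\chi_1(t_1)\cdots\chi_n(t_n)$ be a character of the diagonal torus $(\mathbb{Z}_p^\times)^n$ with values in $K^\times$ which is analytic in the following sense: there are $c_1,\dots,c_n\in K$ with $v_p(c_i)>\frac1{p-1}-1$ such that $\chi_i(t)=\exp(c_i\log t)$ for all $t$ sufficiently close to $1$; if $K$ is ramified over $\mathbb{Q}_p$, this identity is assumed for all $t\in 1+p\mathbb{Z}_p$. Extend $\chi$ to $P^+$ trivially on unipotent matrices. For $w\in W$ put $P_w^+=B\cap wP^+w^{-1}$ and $\chi^w(h)=\chi(w^{-1}hw)$ for $h\in P_w^+$. Identify $wUw^{-1}\cap B$ with $\mathbb{Z}_p^{d}$,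 $d=\frac{n(n-1)}2$, by writing its free entries as $x_{ij}$ (for $i>j$) or $p\,x_{ij}$ (for $i<j$) with $x_{ij}\in\mathbb{Z}_p$, and let $\mathcal{A}(wUw^{-1}\cap B,K)$ be the space of functions $\sum_{\nu}a_\nu x^\nu$ with $a_\nu\in K$, $a_\nu\to 0$, normed by $\sup_\nu|a_\nu|$. Let $\mathrm{ind}_{P_w^+}^B(\chi^w)$ be the space of locally analytic functions $f:B\to K$ with $f(gb)=\chi^w(b^{-1})f(g)$ for all $g\in B$, $b\in P_w^+$, whose restriction to $wUw^{-1}\cap B$ lies in $\mathcal{A}(wUw^{-1}\cap B,K)$. Then, for every $w\in W$, restriction of functions is a $K$-linear isomorphism $$\mathrm{ind}_{P_w^+}^B(\chi^w)\;\cong\;\mathcal{A}(wUw^{-1}\cap B,K);$$ left translation $(h\cdot f)(g)=f(h^{-1}g)$ by $h\in G$ preserves $\mathrm{ind}_{P_w^+}^B(\chi^w)$ and acts on it by bounded operators for the above norm; and this representation of $G$ is globally analytic. That is, identify $G$ with $\mathbb{Z}_p^{n^2}$ as the ordered product of the one-parameter subgroups $1+xE_{i,j}$ ($i>j$, in lexicographic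 order), then $1+pxE_{i,i}$ ($i=1,\dots,n$), then $1+pxE_{i,j}$ ($i<j$, rows from bottom to top, each from right to left), $x\in\mathbb{Z}_p$. Then for every $f$ in the space there are vectors $v_k$ in it ($k\in\mathbb{N}^{n^2}$) with $\|v_k\|\to0$ and $g\cdot f=\sum_k x^k v_k$ for all $g\in G$ with coordinates $x\in\mathbb{Z}_p^{n^2}$. -/

import Mathlib

open Matrix Filter Topology

noncomputable section

namespace WeylInd

section Groups

/-- Upper triangular matrices in `GL_n(R)`. -/
def upperGL (n : ℕ) (R : Type*) [CommRing R] : Subgroup (GL (Fin n) R) where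
  carrier := {g | (g : Matrix (Fin n) (Fin n) R).IsUpperTriangular}
  one_mem' := by simpa using blockTriangular_one
  mul_mem' := fun ha hb => by simpa using ha.mul hb
  inv_mem' := fun {g} hg => by
    have : Invertible (g : Matrix (Fin n) (Fin n) R) := g.invertible
    simpa using blockTriangular_inv_of_blockTriangular hg

/-- Lower triangular matrices in `GL_n(R)`. -/
def lowerGL (n : ℕ) (R : Type*) [CommRing R] : Subgroup (GL (Fin n) R) where
  carrier := {g | (g : Matrix (Fin n) (Fin n) R).IsLowerTriangular}
  one_mem' := by simpa using blockTriangular_one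
  mul_mem' := fun ha hb => by simpa using ha.mul hb
  inv_mem' := fun {g} hg => by
    have : Invertible (g : Matrix (Fin n) (Fin n) R) := g.invertible
    simpa using blockTriangular_inv_of_blockTriangular hg

theorem upper_mul_diag {n : ℕ} {R : Type*} [CommRing R] {a b : Matrix (Fin n) (Fin n) R}
    (ha : a.IsUpperTriangular) (hb : b.IsUpperTriangular) (i : Fin n) :
    (a * b) i i = a i i * b i i := by
  rw [Matrix.mul_apply]
  refine Finset.sum_eq_single_of_mem i (Finset.mem_univ _) fun j _ hj => ?_
  rcases lt_or_gt_of_ne hj with h | h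
  · rw [ha h, zero_mul]
  · rw [hb h, mul_zero]

theorem lower_mul_diag {n : ℕ} {R : Type*} [CommRing R] {a b : Matrix (Fin n) (Fin n) R}
    (ha : a.IsLowerTriangular) (hb : b.IsLowerTriangular) (i : Fin n) :
    (a * b) i i = a i i * b i i := by
  rw [Matrix.mul_apply]
  refine Finset.sum_eq_single_of_mem i (Finset.mem_univ _) fun j _ hj => ?_
  rcases lt_or_gt_of_ne hj with h | h
  · rw [hb (by simpa using h), mul_zero]
  · rw [ha (by simpa using h), zero_mul]

/-- Lower unipotent matrices in `GL_n(R)`. -/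
def lowerUnip (n : ℕ) (R : Type*) [CommRing R] : Subgroup (GL (Fin n) R) where
  carrier := {g | g ∈ lowerGL n R ∧ ∀ i, g i i = 1}
  one_mem' := ⟨one_mem _, fun i => by simp⟩
  mul_mem' := fun {a b} ha hb => ⟨mul_mem ha.1 hb.1, fun i => by
    have := lower_mul_diag ha.1 hb.1 i
    rw [ha.2, hb.2] at this
    simpa using this⟩
  inv_mem' := fun {a} ha => ⟨inv_mem ha.1, fun i => by
    have := lower_mul_diag ha.1 (inv_mem ha.1) i
    rw [ha.2, ← Units.val_mul, mul_inv_cancel] at this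
    simpa using this.symm⟩

/-- The diagonal of an invertible upper triangular matrix, as a family of units. -/
def upperDiag (n : ℕ) (R : Type*) [CommRing R] : upperGL n R →* (Fin n → Rˣ) where
  toFun b i :=
    { val := b.1 i i
      inv := (b⁻¹).1 i i
      val_inv := by
        rw [← upper_mul_diag b.2 (b⁻¹).2]; simp
      inv_val := by
        rw [← upper_mul_diag (b⁻¹).2 b.2]; simp }
  map_one' := by ext i; simp
  map_mul' a b := by ext i; simpa using upper_mul_diag a.2 b.2 i

/-- The permutation matrix `w`, with `w e_j = e_{w(j)}`. -/
def weylGL (n : ℕ) (R : Type*) [CommRing R] (w : Equiv.Perm (Fin n)) : GL (Fin n) R where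
  val := (w⁻¹).permMatrix R
  inv := w.permMatrix R
  val_inv := by rw [← permMatrix_mul]; simp
  inv_val := by rw [← permMatrix_mul]; simp

theorem weylGL_conj_apply {n : ℕ} {R : Type*} [CommRing R] (w : Equiv.Perm (Fin n))
    (g : GL (Fin n) R) (i j : Fin n) :
    (weylGL n R w * g * (weylGL n R w)⁻¹) i j = g (w⁻¹ i) (w⁻¹ j) := by
  change (((w⁻¹).permMatrix R * g.1) * (w.permMatrix R) : Matrix _ _ R) i j = _
  rw [PEquiv.toMatrix_toPEquiv_mul, PEquiv.mul_toMatrix_toPEquiv]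
  rfl

end Groups

section Iwahori
variable (p n : ℕ) [Fact p.Prime]

/-- Reduction modulo `p`. -/
def redGL : GL (Fin n) ℤ_[p] →* GL (Fin n) (ZMod p) :=
  GeneralLinearGroup.map (PadicInt.toZMod (p := p))

/-- The Iwahori subgroup `B`: lower triangular modulo `p`. -/
def iwahori : Subgroup (GL (Fin n) ℤ_[p]) := (lowerGL n (ZMod p)).comap (redGL p n)

/-- The pro-`p` Iwahori subgroup `G`: lower unipotent modulo `p`. -/
def proIwahori : Subgroup (GL (Fin n) ℤ_[p]) := (lowerUnip n (ZMod p)).comap (redGL p n)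

theorem proIwahori_le_iwahori : proIwahori p n ≤ iwahori p n := fun _ hg => hg.1

/-- `P_w^+ = B ∩ w P^+ w⁻¹`. -/
def weylBorel (w : Equiv.Perm (Fin n)) : Subgroup (GL (Fin n) ℤ_[p]) :=
  iwahori p n ⊓ (upperGL n ℤ_[p]).map (MulAut.conj (weylGL n ℤ_[p] w)).toMonoidHom

/-- `w U w⁻¹ ∩ B`. -/
def weylUnip (w : Equiv.Perm (Fin n)) : Subgroup (GL (Fin n) ℤ_[p]) :=
  (lowerUnip n ℤ_[p]).map (MulAut.conj (weylGL n ℤ_[p] w)).toMonoidHom ⊓ iwahori p n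

theorem toZMod_eq_zero_iff {x : ℤ_[p]} : PadicInt.toZMod x = 0 ↔ (p : ℤ_[p]) ∣ x := by
  rw [← RingHom.mem_ker, PadicInt.ker_toZMod, PadicInt.maximalIdeal_eq_span_p,
    Ideal.mem_span_singleton]

theorem mem_iwahori {g : GL (Fin n) ℤ_[p]} :
    g ∈ iwahori p n ↔ ∀ i j, i < j → (p : ℤ_[p]) ∣ g i j := by
  refine ⟨fun h i j hij => ?_, fun h i j hij => ?_⟩
  · exact (toZMod_eq_zero_iff p).1 (h (by simpa using hij))
  · exact (toZMod_eq_zero_iff p).2 (h i j (by simpa using hij))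

theorem mem_proIwahori {g : GL (Fin n) ℤ_[p]} :
    g ∈ proIwahori p n ↔
      (∀ i j, i < j → (p : ℤ_[p]) ∣ g i j) ∧ ∀ i, (p : ℤ_[p]) ∣ g i i - 1 := by
  refine and_congr (mem_iwahori p n) (forall_congr' fun i => ?_)
  rw [← toZMod_eq_zero_iff, map_sub, map_one, sub_eq_zero]
  rfl

end Iwahori

section Charts
variable (p n : ℕ) [Fact p.Prime]

theorem mem_weylUnip {w : Equiv.Perm (Fin n)} {g : GL (Fin n) ℤ_[p]} :
    g ∈ weylUnip p n w ↔ (∀ i j, i < j → (p : ℤ_[p]) ∣ g i j) ∧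
      (∀ i j, w⁻¹ i < w⁻¹ j → g i j = 0) ∧ ∀ i, g i i = 1 := by
  have key : g ∈ (lowerUnip n ℤ_[p]).map (MulAut.conj (weylGL n ℤ_[p] w)).toMonoidHom ↔
      (∀ i j, w⁻¹ i < w⁻¹ j → g i j = 0) ∧ ∀ i, g i i = 1 := by
    constructor
    · rintro ⟨u, ⟨hu, hu1⟩, rfl⟩
      refine ⟨fun i j hij => ?_, fun i => ?_⟩
      · exact (weylGL_conj_apply w u i j).trans (hu (by simpa using hij))
      · exact (weylGL_conj_apply w u i i).trans (hu1 _)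
    · rintro ⟨h0, h1⟩
      have hv : ∀ i j, ((weylGL n ℤ_[p] w)⁻¹ * g * weylGL n ℤ_[p] w) i j = g (w i) (w j) := by
        intro i j
        have := weylGL_conj_apply w ((weylGL n ℤ_[p] w)⁻¹ * g * weylGL n ℤ_[p] w) (w i) (w j)
        simpa [mul_assoc] using this.symm
      refine ⟨(weylGL n ℤ_[p] w)⁻¹ * g * weylGL n ℤ_[p] w, ⟨fun i j hij => ?_, fun i => ?_⟩, ?_⟩
      · exact (hv i j).trans (h0 _ _ (by simpa using hij))
      · exact (hv i i).trans (h1 _)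
      · simp [mul_assoc]
  rw [weylUnip, Subgroup.mem_inf, key, mem_iwahori, and_comm]

/-- The positions of the free entries of `w U w⁻¹`; there are `n (n - 1) / 2` of them. -/
abbrev WeylIdx {n : ℕ} (w : Equiv.Perm (Fin n)) : Type :=
  {q : Fin n × Fin n // w⁻¹ q.2 < w⁻¹ q.1}

/-- The matrix in `w U w⁻¹ ∩ B` with coordinates `x`: the free entry in position `(i, j)` is
`x_{ij}` if `i > j` and `p x_{ij}` if `i < j`. -/
def weylMat (w : Equiv.Perm (Fin n)) (x : WeylIdx w → ℤ_[p]) : Matrix (Fin n) (Fin n) ℤ_[p] :=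
  Matrix.of fun i j =>
    if h : w⁻¹ j < w⁻¹ i then (if i < j then (p : ℤ_[p]) else 1) * x ⟨(i, j), h⟩
    else if i = j then 1 else 0

theorem det_weylMat (w : Equiv.Perm (Fin n)) (x : WeylIdx w → ℤ_[p]) :
    (weylMat p n w x).det = 1 := by
  rw [← Matrix.det_submatrix_equiv_self w, Matrix.det_of_isLowerTriangular]
  · refine Finset.prod_eq_one fun i _ => ?_
    simp [weylMat]
  · intro i j hij
    have hij' : i < j := by simpa using hij
    simp [weylMat, hij'.not_gt, hij'.ne]

theorem weylMat_mem (w : Equiv.Perm (Fin n)) (x : WeylIdx w → ℤ_[p]) :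
    GeneralLinearGroup.mk'' (weylMat p n w x) (by rw [det_weylMat]; exact isUnit_one) ∈
      weylUnip p n w := by
  rw [mem_weylUnip]
  refine ⟨fun i j hij => ?_, fun i j hij => ?_, fun i => ?_⟩
  · change _ ∣ weylMat p n w x i j
    simp only [weylMat, Matrix.of_apply, if_pos hij, hij.ne, if_false]
    split_ifs
    · exact dvd_mul_right _ _
    · exact dvd_zero _
  · change weylMat p n w x i j = 0
    have : i ≠ j := by rintro rfl; exact lt_irrefl _ hij
    simp only [weylMat, Matrix.of_apply, dif_neg hij.not_gt, if_neg this]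
  · change weylMat p n w x i i = 1
    simp [weylMat]

/-- The coordinate system `ℤ_p^{n(n-1)/2} ≃ w U w⁻¹ ∩ B`. -/
def weylChart (w : Equiv.Perm (Fin n)) : (WeylIdx w → ℤ_[p]) ≃ weylUnip p n w :=
  Equiv.ofBijective (fun x => ⟨_, weylMat_mem p n w x⟩) <| by
    have hp0 : (p : ℤ_[p]) ≠ 0 := Nat.cast_ne_zero.2 (Fact.out : p.Prime).ne_zero
    constructor
    · intro x y hxy
      have hM : weylMat p n w x = weylMat p n w y := congrArg (fun g => g.1.1) hxy
      funext ⟨⟨i, j⟩, h⟩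
      have := congrFun (congrFun hM i) j
      simp only [weylMat, Matrix.of_apply] at this
      rw [dif_pos h, dif_pos h] at this
      refine mul_left_cancel₀ ?_ this
      split_ifs
      · exact hp0
      · exact one_ne_zero
    · rintro ⟨g, hg⟩
      have hg' := (mem_weylUnip p n).1 hg
      have hx : ∀ q : WeylIdx w, ∃ y : ℤ_[p],
          g q.1.1 q.1.2 = (if q.1.1 < q.1.2 then (p : ℤ_[p]) else 1) * y := by
        intro q
        split_ifs with h
        · exact hg'.1 _ _ h
        · exact ⟨_, (one_mul _).symm⟩
      choose x hx using hx
      refine ⟨x, Subtype.ext (Units.ext (Matrix.ext fun i j => ?_))⟩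
      change weylMat p n w x i j = g i j
      simp only [weylMat, Matrix.of_apply]
      split_ifs with h1 h2 h3
      · rw [hx ⟨(i, j), h1⟩, if_pos h2]
      · rw [hx ⟨(i, j), h1⟩, if_neg h2]
      · rw [← h3, hg'.2.2]
      · refine (hg'.2.1 _ _ (lt_of_le_of_ne (not_lt.1 h1) ?_)).symm
        simpa using h3

/-- Lower unipotent matrix with entries `x_{ij}`, `i > j`. -/
def lowerMat (x : Fin n × Fin n → ℤ_[p]) : Matrix (Fin n) (Fin n) ℤ_[p] :=
  Matrix.of fun i j => if j < i then x (i, j) else if i = j then 1 else 0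

/-- Diagonal matrix with entries `1 + p x_{ii}`. -/
def diagMat (x : Fin n × Fin n → ℤ_[p]) : Matrix (Fin n) (Fin n) ℤ_[p] :=
  Matrix.diagonal fun i => 1 + p * x (i, i)

/-- Upper unipotent matrix with entries `p x_{ij}`, `i < j`. -/
def upperMat (x : Fin n × Fin n → ℤ_[p]) : Matrix (Fin n) (Fin n) ℤ_[p] :=
  Matrix.of fun i j => if i < j then p * x (i, j) else if i = j then 1 else 0

theorem isUnit_one_add_p_mul (y : ℤ_[p]) : IsUnit (1 + (p : ℤ_[p]) * y) := by
  refine (IsLocalRing.isUnit_or_isUnit_of_isUnit_add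
    (a := 1 + (p : ℤ_[p]) * y) (b := -(p * y)) (by simp)).resolve_right ?_
  rw [IsUnit.neg_iff]
  exact fun h => PadicInt.prime_p.not_isUnit (isUnit_of_mul_isUnit_left h)

theorem lowerMat_tri (x : Fin n × Fin n → ℤ_[p]) : (lowerMat p n x).IsLowerTriangular := by
  intro i j hij
  have hij' : i < j := by simpa using hij
  simp [lowerMat, hij'.not_gt, hij'.ne]

theorem upperMat_tri (x : Fin n × Fin n → ℤ_[p]) : (upperMat p n x).IsUpperTriangular := by
  intro i j hij
  have hij' : j < i := by simpa using hij
  simp [upperMat, hij'.not_gt, hij'.ne']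

/-- `lowerMat` as an element of `GL_n(ℤ_p)`. -/
def lowerElt (x : Fin n × Fin n → ℤ_[p]) : GL (Fin n) ℤ_[p] :=
  GeneralLinearGroup.mk'' (lowerMat p n x) <| by
    rw [Matrix.det_of_isLowerTriangular _ (lowerMat_tri p n x),
      Finset.prod_eq_one fun i _ => by simp [lowerMat]]
    exact isUnit_one

/-- `diagMat` as an element of `GL_n(ℤ_p)`. -/
def diagElt (x : Fin n × Fin n → ℤ_[p]) : GL (Fin n) ℤ_[p] :=
  GeneralLinearGroup.mk'' (diagMat p n x) <| by
    rw [diagMat, Matrix.det_diagonal, IsUnit.prod_univ_iff]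
    exact fun i => isUnit_one_add_p_mul p _

/-- `upperMat` as an element of `GL_n(ℤ_p)`. -/
def upperElt (x : Fin n × Fin n → ℤ_[p]) : GL (Fin n) ℤ_[p] :=
  GeneralLinearGroup.mk'' (upperMat p n x) <| by
    rw [Matrix.det_of_isUpperTriangular (upperMat_tri p n x),
      Finset.prod_eq_one fun i _ => by simp [upperMat]]
    exact isUnit_one

theorem ldu_mem (x : Fin n × Fin n → ℤ_[p]) :
    lowerElt p n x * diagElt p n x * upperElt p n x ∈ proIwahori p n := by
  refine mul_mem (mul_mem ?_ ?_) ?_ <;> rw [mem_proIwahori]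
  · refine ⟨fun i j hij => ?_, fun i => ?_⟩
    · change _ ∣ lowerMat p n x i j
      simp [lowerMat, hij.not_gt, hij.ne]
    · change _ ∣ lowerMat p n x i i - 1
      simp [lowerMat]
  · refine ⟨fun i j hij => ?_, fun i => ?_⟩
    · change _ ∣ diagMat p n x i j
      simp [diagMat, hij.ne]
    · change _ ∣ diagMat p n x i i - 1
      simp [diagMat]
  · refine ⟨fun i j hij => ?_, fun i => ?_⟩
    · change _ ∣ upperMat p n x i j
      simp [upperMat, hij]
    · change _ ∣ upperMat p n x i i - 1
      simp [upperMat]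

theorem exists_ldu (M : Matrix (Fin n) (Fin n) ℤ_[p])
    (h0 : ∀ i j, i < j → (p : ℤ_[p]) ∣ M i j) (h1 : ∀ i, (p : ℤ_[p]) ∣ M i i - 1) :
    ∃ x, lowerMat p n x * diagMat p n x * upperMat p n x = M := by
  induction n with
  | zero => exact ⟨0, Matrix.ext fun i => i.elim0⟩
  | succ n ih =>
    obtain ⟨a, ha⟩ := h1 0
    have ha' : M 0 0 = 1 + p * a := by rw [← ha]; ring
    obtain ⟨u, hu⟩ := isUnit_one_add_p_mul p a
    have hb : ∀ j : Fin n, ∃ b, M 0 j.succ = p * b := fun j => h0 _ _ (Fin.succ_pos j)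
    choose b hb using hb
    obtain ⟨x, hx⟩ := ih (Matrix.of fun i j => M i.succ j.succ - M i.succ 0 * ↑u⁻¹ * (p * b j))
      (fun i j hij => by
        refine dvd_sub (h0 _ _ (Fin.succ_lt_succ_iff.2 hij)) ?_
        exact dvd_mul_of_dvd_right (dvd_mul_right _ _) _)
      (fun i => by
        have : (p : ℤ_[p]) ∣ M i.succ 0 * ↑u⁻¹ * (p * b i) :=
          dvd_mul_of_dvd_right (dvd_mul_right _ _) _
        have h2 := dvd_sub (h1 i.succ) this
        simp only [Matrix.of_apply]
        convert h2 using 1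
        ring)
    refine ⟨fun q => Fin.cases (motive := fun _ => ℤ_[p])
      (Fin.cases (motive := fun _ => ℤ_[p]) a (fun j => ↑u⁻¹ * b j) q.2)
      (fun i => Fin.cases (motive := fun _ => ℤ_[p]) (M i.succ 0 * ↑u⁻¹)
        (fun j => x (i, j)) q.2) q.1, ?_⟩
    have huu : (u : ℤ_[p]) * ↑u⁻¹ = 1 := by simp
    ext1 i j
    simp only [diagMat, Matrix.mul_apply (M := _ * _), Matrix.mul_diagonal]
    rw [Fin.sum_univ_succ]
    refine Fin.cases ?_ (fun i => ?_) i <;> refine Fin.cases ?_ (fun j => ?_) j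
    · simp [lowerMat, upperMat, ha']
    · simp [lowerMat, upperMat, hb, ← hu, (Fin.succ_ne_zero _).symm]
      linear_combination (p * b j) * huu
    · simp [lowerMat, upperMat, ← hu]
    · have := congrFun (congrFun hx i) j
      simp only [diagMat, Matrix.mul_apply (M := _ * _), Matrix.mul_diagonal] at this
      simp only [lowerMat, upperMat, Matrix.of_apply] at this ⊢
      simp [← hu, Fin.succ_inj] at this ⊢
      rw [this]
      ring

/-- The coordinate system `ℤ_p^{n²} ≃ G`: the ordered product of the one-parameter subgroups
`1 + x E_{ij}` for `i > j` (lexicographically), then `1 + p x E_{ii}` for `i = 1, …, n`, then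
`1 + p x E_{ij}` for `i < j` (rows from the bottom to the top, each from the right to the left).
In each of the two unipotent groups `E_{ij} E_{kl} = 0` whenever `(i, j)` comes before `(k, l)`,
so that the three partial products are the three matrices below. -/
def proIwahoriChart : (Fin n × Fin n → ℤ_[p]) ≃ proIwahori p n :=
  Equiv.ofBijective
    (fun x => ⟨lowerElt p n x * diagElt p n x * upperElt p n x, ldu_mem p n x⟩) <| by
    have hp0 : (p : ℤ_[p]) ≠ 0 := Nat.cast_ne_zero.2 (Fact.out : p.Prime).ne_zero
    constructor
    · intro x y hxy
      have hxy : lowerElt p n x * diagElt p n x * upperElt p n x =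
        lowerElt p n y * diagElt p n y * upperElt p n y := congrArg Subtype.val hxy
      have hl : ∀ z, lowerElt p n z ∈ lowerUnip n ℤ_[p] := fun z =>
        ⟨lowerMat_tri p n z, fun i => by change lowerMat p n z i i = 1; simp [lowerMat]⟩
      have hd : ∀ z, diagElt p n z * upperElt p n z ∈ upperGL n ℤ_[p] := fun z =>
        mul_mem (show (diagMat p n z).IsUpperTriangular from blockTriangular_diagonal _)
          (upperMat_tri p n z)
      have he : (lowerElt p n y)⁻¹ * lowerElt p n x =
          (diagElt p n y * upperElt p n y) * (diagElt p n x * upperElt p n x)⁻¹ := by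
        rw [eq_mul_inv_iff_mul_eq, mul_assoc, inv_mul_eq_iff_eq_mul]
        simpa only [mul_assoc] using hxy
      have h1 : (lowerElt p n y)⁻¹ * lowerElt p n x = 1 := by
        have hL := mul_mem (inv_mem (hl y)) (hl x)
        have hU := he ▸ mul_mem (hd y) (inv_mem (hd x))
        refine Units.ext (Matrix.ext fun i j => ?_)
        rcases lt_trichotomy i j with h | h | h
        · rw [hL.1 (by simpa using h)]; simp [h.ne]
        · subst h; rw [hL.2]; simp
        · rw [hU (by simpa using h)]; simp [h.ne']
      have hLL : lowerElt p n y = lowerElt p n x := inv_mul_eq_one.1 h1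
      rw [h1, eq_comm, mul_inv_eq_one] at he
      have hLm : lowerMat p n y = lowerMat p n x := congrArg Units.val hLL
      have hDm : diagMat p n y * upperMat p n y = diagMat p n x * upperMat p n x :=
        congrArg Units.val he
      have hdd : ∀ i, y (i, i) = x (i, i) := by
        intro i
        have := congrFun (congrFun hDm i) i
        simpa [diagMat, upperMat, Matrix.diagonal_mul, hp0] using this
      funext ⟨i, j⟩
      rcases lt_trichotomy i j with h | h | h
      · have := congrFun (congrFun hDm i) j
        simpa [diagMat, upperMat, Matrix.diagonal_mul, hp0, h, hdd,
          (isUnit_one_add_p_mul p _).ne_zero] using this.symm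
      · subst h; exact (hdd i).symm
      · have := congrFun (congrFun hLm i) j
        simpa [lowerMat, h] using this.symm
    · rintro ⟨g, hg⟩
      obtain ⟨h0, h1⟩ := (mem_proIwahori p n).1 hg
      obtain ⟨x, hx⟩ := exists_ldu p n g.1 h0 h1
      exact ⟨x, Subtype.ext (Units.ext hx)⟩

end Charts

section Analytic

/-- The value in `K` of the monomial `x^k` at a point `x` of the polydisc `ℤ_p^σ`. -/
def monomialVal (p : ℕ) [Fact p.Prime] (K : Type*) [NormedField K] [NormedAlgebra ℚ_[p] K]
    {σ : Type*} (k : σ →₀ ℕ) (x : σ → ℤ_[p]) : K :=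
  algebraMap ℚ_[p] K (k.prod fun i e => (x i : ℚ_[p]) ^ e)

/-- `F : ℤ_p^σ → V` is globally analytic: `F(x) = ∑_k x^k v_k` with `‖v_k‖ → 0`. -/
def IsGloballyAnalytic (p : ℕ) [Fact p.Prime] (K : Type*) [NormedField K] [NormedAlgebra ℚ_[p] K]
    {σ V : Type*} [NormedAddCommGroup V] [NormedSpace K V] (F : (σ → ℤ_[p]) → V) : Prop :=
  ∃ v : (σ →₀ ℕ) → V, Tendsto v cofinite (𝓝 0) ∧
    ∀ x, HasSum (fun k => monomialVal p K k x • v k) (F x)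

/-- Families `(a_k)` tending to zero, among the bounded families with the norm `sup_k |a_k|`. -/
def tateSubmodule (K : Type*) [NormedField K] (σ : Type*) :
    Submodule K (lp (fun _ : σ →₀ ℕ => K) ⊤) where
  carrier := {a | Tendsto (fun k => a k) cofinite (𝓝 0)}
  zero_mem' := tendsto_const_nhds
  add_mem' {a b} ha hb := by
    have h : Tendsto (fun k => a k + b k) cofinite (𝓝 (0 + 0)) := Tendsto.add ha hb
    rw [add_zero] at h
    exact h
  smul_mem' c a ha := by
    have h : Tendsto (fun k => c * a k) cofinite (𝓝 (c * 0)) := Tendsto.const_mul c ha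
    rw [mul_zero] at h
    exact h

/-- The Tate algebra of the polydisc `ℤ_p^σ` over `K`, as a normed space: power series with
coefficients `a_k` tending to zero, with the norm `sup_k |a_k|`. -/
def TateSpace (K : Type*) [NormedField K] (σ : Type*) : Type _ := tateSubmodule K σ

instance (K : Type*) [NormedField K] (σ : Type*) : NormedAddCommGroup (TateSpace K σ) :=
  inferInstanceAs (NormedAddCommGroup (tateSubmodule K σ))

instance (K : Type*) [NormedField K] (σ : Type*) : NormedSpace K (TateSpace K σ) :=
  inferInstanceAs (NormedSpace K (tateSubmodule K σ))

/-- The coefficients of an element of the Tate algebra. -/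
def TateSpace.coeff {K : Type*} [NormedField K] {σ : Type*} (a : TateSpace K σ) (k : σ →₀ ℕ) : K :=
  (a.1 : ∀ _ : σ →₀ ℕ, K) k

/-- A representation of `G` on a normed space `V` is globally analytic if every orbit map
`g ↦ ρ(g) v` is a globally analytic function on `G`. -/
def IsGloballyAnalyticRep (p : ℕ) [Fact p.Prime] (K : Type*) [NormedField K]
    [NormedAlgebra ℚ_[p] K] {n : ℕ} {V : Type*} [NormedAddCommGroup V] [NormedSpace K V]
    (ρ : proIwahori p n →* (V →L[K] V)) : Prop :=
  ∀ v : V, IsGloballyAnalytic p K fun x => ρ (proIwahoriChart p n x) v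

/-- `f` is locally analytic on `B`: near each `g ∈ B`, namely on some `g + p^m M_n(ℤ_p)`, it is
given by a convergent power series in the matrix entries. -/
def IsLocallyAnalytic (p : ℕ) [Fact p.Prime] (K : Type*) [NormedField K] [NormedAlgebra ℚ_[p] K]
    {n : ℕ} (f : iwahori p n → K) : Prop :=
  ∀ g : iwahori p n, ∃ m : ℕ, ∃ F : (Fin n × Fin n → ℤ_[p]) → K, IsGloballyAnalytic p K F ∧
    ∀ (h : iwahori p n) (x : Fin n × Fin n → ℤ_[p]),
      (∀ i j, h.1 i j = g.1 i j + (p : ℤ_[p]) ^ m * x (i, j)) → f h = F x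

variable {p : ℕ} [Fact p.Prime] {K : Type*} [NormedField K] [NormedAlgebra ℚ_[p] K]
  {σ V : Type*} [NormedAddCommGroup V] [NormedSpace K V]

theorem IsGloballyAnalytic.zero : IsGloballyAnalytic p K (fun _ : σ → ℤ_[p] => (0 : V)) :=
  ⟨0, tendsto_const_nhds, fun x => by simp⟩

theorem IsGloballyAnalytic.add {F F' : (σ → ℤ_[p]) → V} (h : IsGloballyAnalytic p K F)
    (h' : IsGloballyAnalytic p K F') : IsGloballyAnalytic p K fun x => F x + F' x := by
  obtain ⟨v, hv, hs⟩ := h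
  obtain ⟨v', hv', hs'⟩ := h'
  exact ⟨fun k => v k + v' k, by simpa using hv.add hv', fun x => by
    simpa only [smul_add] using (hs x).add (hs' x)⟩

theorem IsGloballyAnalytic.const_smul {F : (σ → ℤ_[p]) → V} (c : K)
    (h : IsGloballyAnalytic p K F) : IsGloballyAnalytic p K fun x => c • F x := by
  obtain ⟨v, hv, hs⟩ := h
  exact ⟨fun k => c • v k, by simpa using hv.const_smul c, fun x => by
    simpa only [smul_comm _ c] using (hs x).const_smul c⟩

theorem norm_monomialVal_le (k : σ →₀ ℕ) (x : σ → ℤ_[p]) : ‖monomialVal p K k x‖ ≤ 1 := by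
  rw [monomialVal, norm_algebraMap', Finsupp.prod, norm_prod]
  exact Finset.prod_le_one (fun _ _ => norm_nonneg _) fun i _ => by
    rw [norm_pow]
    exact pow_le_one₀ (norm_nonneg _) (x i).2

theorem IsGloballyAnalytic.comp_mul {F : (σ → ℤ_[p]) → V} (c : ℤ_[p])
    (h : IsGloballyAnalytic p K F) : IsGloballyAnalytic p K fun x => F fun i => c * x i := by
  obtain ⟨v, hv, hs⟩ := h
  refine ⟨fun k => monomialVal p K k (fun _ => c) • v k, ?_, fun x => ?_⟩
  · rw [tendsto_zero_iff_norm_tendsto_zero] at hv ⊢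
    refine squeeze_zero (fun _ => norm_nonneg _) (fun k => ?_) hv
    rw [norm_smul]
    exact mul_le_of_le_one_left (norm_nonneg _) (norm_monomialVal_le k _)
  · convert hs (fun i => c * x i) using 2 with k
    rw [smul_smul]
    congr 1
    simp only [monomialVal, ← map_mul, ← Finsupp.prod_mul, PadicInt.coe_mul, mul_pow]
    congr 2
    ext
    rw [mul_comm]

theorem IsLocallyAnalytic.add {n : ℕ} {f f' : iwahori p n → K} (h : IsLocallyAnalytic p K f)
    (h' : IsLocallyAnalytic p K f') : IsLocallyAnalytic p K (f + f') := by
  intro g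
  obtain ⟨m, F, hF, hf⟩ := h g
  obtain ⟨m', F', hF', hf'⟩ := h' g
  refine ⟨m + m', _, (hF.comp_mul ((p : ℤ_[p]) ^ m')).add (hF'.comp_mul ((p : ℤ_[p]) ^ m)),
    fun a x hx => ?_⟩
  rw [Pi.add_apply, hf a (fun i => (p : ℤ_[p]) ^ m' * x i) fun i j => by rw [hx]; ring,
    hf' a (fun i => (p : ℤ_[p]) ^ m * x i) fun i j => by rw [hx]; ring]

theorem IsLocallyAnalytic.smul {n : ℕ} {f : iwahori p n → K} (c : K)
    (h : IsLocallyAnalytic p K f) : IsLocallyAnalytic p K (c • f) := by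
  intro g
  obtain ⟨m, F, hF, hf⟩ := h g
  exact ⟨m, _, hF.const_smul c, fun a x hx => by rw [Pi.smul_apply, hf a x hx]⟩

end Analytic

section Characters

/-- The `p`-adic logarithm series `log t = ∑ (-1)^k (t - 1)^{k+1} / (k + 1)`. -/
def padicLog (p : ℕ) [Fact p.Prime] (t : ℤ_[p]) : ℚ_[p] :=
  ∑' k : ℕ, (-1) ^ k * ((t : ℚ_[p]) - 1) ^ (k + 1) / (k + 1)

/-- `t ^ c = exp (c log t)`, for `t` close to `1`. -/
def padicPow (p : ℕ) [Fact p.Prime] {K : Type*} [NormedField K] [NormedAlgebra ℚ_[p] K]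
    (t : ℤ_[p]) (c : K) : K :=
  ∑' k : ℕ, (c * algebraMap ℚ_[p] K (padicLog p t)) ^ k / (k.factorial : K)

/-- `K / ℚ_p` has ramification index one. -/
def IsUnramifiedOver (p : ℕ) (K : Type*) [NormedField K] : Prop :=
  ∀ x : K, x ≠ 0 → ∃ m : ℤ, ‖x‖ = (p : ℝ) ^ m

/-- The character `χ(t_1, …, t_n) = ∏ χ_i(t_i)` of the torus is analytic with exponents `c_i`:
`χ_i(t) = t ^ c_i` for `t` close to `1`, where `v_p(c_i) > 1 / (p - 1) - 1`; if `K` is ramified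
over `ℚ_p`, then `χ_i(t) = t ^ c_i` is required on the whole of `1 + p ℤ_p`. -/
structure IsAnalyticCharacter (p : ℕ) [Fact p.Prime] {K : Type*} [NormedField K]
    [NormedAlgebra ℚ_[p] K] {n : ℕ} (χ : Fin n → (ℤ_[p]ˣ →* Kˣ)) (c : Fin n → K) : Prop where
  norm_lt : ∀ i, ‖c i‖ < (p : ℝ) ^ (1 - 1 / ((p : ℝ) - 1))
  near_one : ∀ i, ∃ m : ℕ, ∀ t : ℤ_[p]ˣ, (p : ℤ_[p]) ^ m ∣ (t : ℤ_[p]) - 1 →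
    (χ i t : K) = padicPow p (t : ℤ_[p]) (c i)
  unramified_or : IsUnramifiedOver p K ∨ ∀ i, ∀ t : ℤ_[p]ˣ, (p : ℤ_[p]) ∣ (t : ℤ_[p]) - 1 →
    (χ i t : K) = padicPow p (t : ℤ_[p]) (c i)

/-- The extension of `χ` to the upper triangular matrices, trivial on unipotent matrices. -/
def borelChar {R M : Type*} [CommRing R] [CommGroup M] {n : ℕ} (χ : Fin n → (Rˣ →* M)) :
    upperGL n R →* M :=
  ∏ i, (χ i).comp ((Pi.evalMonoidHom (fun _ : Fin n => Rˣ) i).comp (upperDiag n R))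

/-- `P_w^+ → P^+`, `h ↦ w⁻¹ h w`. -/
def weylConj (p n : ℕ) [Fact p.Prime] (w : Equiv.Perm (Fin n)) :
    weylBorel p n w →* upperGL n ℤ_[p] :=
  MonoidHom.codRestrict
    ((MulAut.conj (weylGL n ℤ_[p] w)⁻¹).toMonoidHom.comp (weylBorel p n w).subtype) _ <| by
    rintro ⟨_, _, u, hu, rfl⟩
    simpa [mul_assoc] using hu

/-- `χ^w(h) = χ(w⁻¹ h w)` on `P_w^+`. -/
def weylChar {p n : ℕ} [Fact p.Prime] {M : Type*} [CommGroup M]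
    (χ : Fin n → (ℤ_[p]ˣ →* M)) (w : Equiv.Perm (Fin n)) : weylBorel p n w →* M :=
  (borelChar χ).comp (weylConj p n w)

end Characters

section Induction
variable {p n : ℕ} [Fact p.Prime] {K : Type*} [NormedField K] [NormedAlgebra ℚ_[p] K]

/-- The locally analytic induction `ind_{P_w^+}^B(χ^w)_loc`: locally analytic `f : B → K` with
`f(g b) = χ^w(b⁻¹) f(g)` for `b ∈ P_w^+`. -/
def indLoc (χ : Fin n → (ℤ_[p]ˣ →* Kˣ)) (w : Equiv.Perm (Fin n)) :
    Submodule K (iwahori p n → K) where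
  carrier := {f | IsLocallyAnalytic p K f ∧ ∀ (g : iwahori p n) (b : weylBorel p n w),
    f (g * Subgroup.inclusion inf_le_left b) = (weylChar χ w b⁻¹ : Kˣ) * f g}
  zero_mem' := ⟨fun _ => ⟨0, _, IsGloballyAnalytic.zero, fun _ _ _ => rfl⟩, fun g b => by simp⟩
  add_mem' ha hb := ⟨ha.1.add hb.1, fun g b => by
    rw [Pi.add_apply, Pi.add_apply, ha.2, hb.2, mul_add]⟩
  smul_mem' c a ha := ⟨ha.1.smul c, fun g b => by
    rw [Pi.smul_apply, Pi.smul_apply, ha.2, smul_eq_mul, smul_eq_mul, mul_left_comm]⟩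

/-- A point of `w U w⁻¹ ∩ B` given by its coordinates, as an element of `B`. -/
def weylPoint (w : Equiv.Perm (Fin n)) (y : WeylIdx w → ℤ_[p]) : iwahori p n :=
  Subgroup.inclusion inf_le_right (weylChart p n w y)

/-- The globally analytic vectors `ind_{P_w^+}^B(χ^w)`: the functions of the locally analytic
induction that are globally analytic on `w U w⁻¹ ∩ B ≅ ℤ_p^{n(n-1)/2}`. -/
def indGlob (χ : Fin n → (ℤ_[p]ˣ →* Kˣ)) (w : Equiv.Perm (Fin n)) :
    Submodule K (iwahori p n → K) where
  carrier := {f | f ∈ indLoc χ w ∧ IsGloballyAnalytic p K fun y => f (weylPoint w y)}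
  zero_mem' := ⟨zero_mem _, IsGloballyAnalytic.zero⟩
  add_mem' ha hb := ⟨add_mem ha.1 hb.1, ha.2.add hb.2⟩
  smul_mem' c _ ha := ⟨Submodule.smul_mem _ c ha.1, ha.2.const_smul c⟩

/-- Left translation: `(h · f)(g) = f(h⁻¹ g)` for `h ∈ G`, `g ∈ B`. -/
def translate (h : proIwahori p n) (f : iwahori p n → K) : iwahori p n → K :=
  fun g => f ((Subgroup.inclusion (proIwahori_le_iwahori p n) h)⁻¹ * g)

end Induction

end WeylInd

end

/-! Everything comes from one Gaussian elimination performed over a ring of functions. Let A be the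
ring `integralAnalytic` of ℤ_p-valued functions on a polydisc given by power series with
coefficients in ℤ_p tending to zero. An element 1 + pφ of A is a unit (geometric series), and
elimination needs nothing more: a matrix over A with unit diagonal and with entries above the
diagonal divisible by p factors, after reindexing by w, as a matrix of the shape of wUw⁻¹ ∩ B times
an upper triangular one (`exists_lower_mul_upper`, `exists_unipMatrix_mul_upper`). Over ℤ_p the same
elimination gives B = (wUw⁻¹ ∩ B) P_w^+. The two factors meet trivially, so equivariant functions on
B correspond to arbitrary functions on wUw⁻¹ ∩ B.

Over A, with variables (x, y), the elimination is applied to N(x)⁻¹ W(y), where N and W are the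
charts of G and of wUw⁻¹ ∩ B. This matrix is lower unipotent modulo p, so its unipotent factor has
coordinates y' in A and its upper factor has diagonal entries β_i ≡ 1 modulo p. Hence the translate
of f by the element with coordinates x takes at y the value ∏ χ_i(β_i)⁻¹ · f(y'). On 1 + pA the
character χ_i is exp(c_i log): the logarithm keeps the Gauss norm at most 1/p, and the bound on c_i
puts c_i log inside the domain of convergence of exp, with result of norm at most 1. So the
translate is jointly analytic in (x, y), with norm at most that of f (`isAnalyticLE_translate`).
Fixing x gives boundedness of the operators; grouping the series by powers of x gives the vectors
v_k (`TateSpace.isGloballyAnalytic_of_joint`).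

Three points remain. For unramified K, the identity χ_i = exp(c_i log) near 1 extends to 1 + pℤ_p,
because the two sides have equal p^m-th powers and K has no nontrivial p-power roots of unity
(`IsAnalyticCharacter.eq_padicPow`). Coefficients are determined by values
(`eq_zero_of_hasSum_monomialVal`), so the Tate norm is a norm on functions. Finally, equivariance
together with analyticity on wUw⁻¹ ∩ B already forces local analyticity on B
(`isLocallyAnalytic_of_equivariant`). -/

namespace WeylInd

/-! ### Families tending to zero and sums in ultrametric groups. -/

section Ultrametric

variable {E : Type*} [NormedAddCommGroup E] [IsUltrametricDist E]

theorem norm_hasSum_le {ι : Type*} {f : ι → E} {a : E} {C : ℝ} (hf : HasSum f a) (hC : 0 ≤ C)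
    (h : ∀ i, ‖f i‖ ≤ C) : ‖a‖ ≤ C := by
  rw [← hf.tsum_eq]
  exact IsUltrametricDist.norm_tsum_le_of_forall_le_of_nonneg hC h

omit [IsUltrametricDist E] in
theorem tendsto_cofinite_zero_iff {ι : Type*} {f : ι → E} :
    Tendsto f cofinite (𝓝 0) ↔ ∀ ε > 0, {i | ε < ‖f i‖}.Finite := by
  rw [Metric.tendsto_nhds]
  constructor
  · intro h ε hε
    refine (h ε hε).subset fun i hi => ?_
    simpa using le_of_lt hi
  · intro h ε hε
    refine (h (ε / 2) (half_pos hε)).subset fun i hi => ?_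
    have : ε ≤ ‖f i‖ := by simpa using hi
    exact lt_of_lt_of_le (half_lt_self hε) this

omit [IsUltrametricDist E] in
/-- A double family tending to zero, bounded rowwise, has rows tending uniformly to zero. -/
theorem tendsto_cofinite_zero_of_rows {α β F : Type*} [NormedAddCommGroup F] {u : α × β → E}
    (hu : Tendsto u cofinite (𝓝 0)) {v : α → F}
    (hv : ∀ a, ∀ ε > 0, (∀ b, ‖u (a, b)‖ ≤ ε) → ‖v a‖ ≤ ε) : Tendsto v cofinite (𝓝 0) := by
  rw [tendsto_cofinite_zero_iff] at hu ⊢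
  intro ε hε
  refine ((hu ε hε).image Prod.fst).subset fun a ha => ?_
  by_contra hcon
  refine absurd (hv a ε hε fun b => ?_) (not_le.2 ha)
  by_contra hb
  exact hcon ⟨(a, b), not_le.1 hb, rfl⟩

omit [IsUltrametricDist E] in
theorem exists_norm_le_of_tendsto_cofinite {ι : Type*} {v : ι → E}
    (hv : Tendsto v cofinite (𝓝 0)) : ∃ C, 0 ≤ C ∧ ∀ i, ‖v i‖ ≤ C := by
  obtain ⟨C, hC⟩ := ((tendsto_cofinite_zero_iff.1 hv 1 one_pos).image fun i => ‖v i‖).bddAbove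
  refine ⟨max C 1, by positivity, fun i => ?_⟩
  by_cases hi : 1 < ‖v i‖
  · exact le_max_of_le_left (hC ⟨i, hi, rfl⟩)
  · exact le_max_of_le_right (not_lt.1 hi)

theorem nonarchimedeanRing (K : Type*) [NormedField K] [IsUltrametricDist K] :
    NonarchimedeanRing K where
  is_nonarchimedean := NonarchimedeanAddGroup.is_nonarchimedean

end Ultrametric

/-! ### Calculus of power series on the polydisc with bounds on the Gauss norm. -/

section AnalyticLE

variable (p : ℕ) [Fact p.Prime] (K : Type*) [NormedField K] [NormedAlgebra ℚ_[p] K] {σ τ : Type*}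

/-- `F(x) = ∑_k a_k x^k` with `a_k → 0` and `|a_k| ≤ r`. -/
def IsAnalyticLE (r : ℝ) (F : (σ → ℤ_[p]) → K) : Prop :=
  ∃ v : (σ →₀ ℕ) → K, Tendsto v cofinite (𝓝 0) ∧ (∀ k, ‖v k‖ ≤ r) ∧
    ∀ x, HasSum (fun k => monomialVal p K k x * v k) (F x)

variable {p K}

theorem norm_natCast_prime : ‖(p : K)‖ = (p : ℝ)⁻¹ := by
  rw [← map_natCast (algebraMap ℚ_[p] K), norm_algebraMap', Padic.norm_p]

@[simp]
theorem monomialVal_zero (x : σ → ℤ_[p]) : monomialVal p K 0 x = 1 := by simp [monomialVal]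

theorem monomialVal_add (k l : σ →₀ ℕ) (x : σ → ℤ_[p]) :
    monomialVal p K (k + l) x = monomialVal p K k x * monomialVal p K l x := by
  rw [monomialVal, Finsupp.prod_add_index' (by simp) (by intros; rw [pow_add]), map_mul]
  rfl

theorem monomialVal_single (i : σ) (x : σ → ℤ_[p]) :
    monomialVal p K (Finsupp.single i 1) x = algebraMap ℚ_[p] K (x i) := by
  simp [monomialVal]

theorem norm_monomialVal_mul_le (k : σ →₀ ℕ) (x : σ → ℤ_[p]) (a : K) :
    ‖monomialVal p K k x * a‖ ≤ ‖a‖ := by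
  rw [norm_mul]
  exact mul_le_of_le_one_left (norm_nonneg _) (norm_monomialVal_le k x)

namespace IsAnalyticLE

variable {F F' : (σ → ℤ_[p]) → K} {r s : ℝ}

theorem mono (h : IsAnalyticLE p K r F) (hrs : r ≤ s) : IsAnalyticLE p K s F := by
  obtain ⟨v, h1, h2, h3⟩ := h
  exact ⟨v, h1, fun k => (h2 k).trans hrs, h3⟩

theorem nonneg (h : IsAnalyticLE p K r F) : 0 ≤ r := by
  obtain ⟨v, -, h2, -⟩ := h
  exact (norm_nonneg _).trans (h2 0)

theorem isGloballyAnalytic (h : IsAnalyticLE p K r F) : IsGloballyAnalytic p K F := by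
  obtain ⟨v, h1, -, h3⟩ := h
  exact ⟨v, h1, h3⟩

theorem norm_le [IsUltrametricDist K] (h : IsAnalyticLE p K r F) (x : σ → ℤ_[p]) :
    ‖F x‖ ≤ r := by
  have hr := h.nonneg
  obtain ⟨v, -, h2, h3⟩ := h
  exact norm_hasSum_le (h3 x) hr fun k => (norm_monomialVal_mul_le k x _).trans (h2 k)

theorem monomial (k : σ →₀ ℕ) (a : K) :
    IsAnalyticLE p K ‖a‖ fun x => monomialVal p K k x * a := by
  classical
  refine ⟨Pi.single k a, ?_, fun l => ?_, fun x => ?_⟩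
  · refine tendsto_nhds_of_eventually_eq ?_
    refine (Set.finite_singleton k).subset fun l hl => ?_
    by_contra h
    exact hl (Pi.single_eq_of_ne h _)
  · by_cases h : l = k
    · subst h; simp
    · simp [Pi.single_eq_of_ne h]
  · convert hasSum_single k fun l hl => ?_
    · simp
    · simp [Pi.single_eq_of_ne hl]

theorem const (a : K) : IsAnalyticLE p K ‖a‖ fun _ : σ → ℤ_[p] => a := by
  simpa using monomial (p := p) (0 : σ →₀ ℕ) a

theorem coord (i : σ) : IsAnalyticLE p K 1 fun x : σ → ℤ_[p] => algebraMap ℚ_[p] K (x i) := by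
  simpa [monomialVal_single] using monomial (p := p) (Finsupp.single i 1) (1 : K)

theorem one : IsAnalyticLE p K 1 fun _ : σ → ℤ_[p] => (1 : K) := by
  simpa using const (p := p) (σ := σ) (1 : K)

variable [CompleteSpace K] [IsUltrametricDist K]

/-- A uniformly convergent sum of analytic functions is analytic. -/
theorem hasSum {ι : Type*} {G : ι → (σ → ℤ_[p]) → K} {R : ι → ℝ} {C : ℝ} (hC : 0 ≤ C)
    (hG : ∀ i, IsAnalyticLE p K (R i) (G i)) (hR : Tendsto R cofinite (𝓝 0))
    (hRC : ∀ i, R i ≤ C) (hF : ∀ x, HasSum (fun i => G i x) (F x)) : IsAnalyticLE p K C F := by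
  choose v hv hvR hvs using hG
  -- A coefficient larger than ε occurs only in the finitely many series with bound `R i` above ε,
  -- and finitely often in each of them.
  have hu : Tendsto (fun q : (σ →₀ ℕ) × ι => v q.2 q.1) cofinite (𝓝 0) := by
    rw [tendsto_cofinite_zero_iff]
    intro ε hε
    have hfin : {i | ε < ‖R i‖}.Finite := tendsto_cofinite_zero_iff.1 hR ε hε
    refine (hfin.biUnion fun i _ =>
      (tendsto_cofinite_zero_iff.1 (hv i) ε hε).image fun k => (k, i)).subset ?_
    rintro ⟨k, i⟩ hq
    have hq' : ε < ‖v i k‖ := hq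
    simp only [Set.mem_iUnion, Set.mem_image]
    exact ⟨i, (hq'.trans_le (hvR i k)).trans_le (le_abs_self _), k, hq, rfl⟩
  have hrow : ∀ k, Summable fun i => v i k := fun k =>
    NonarchimedeanAddGroup.summable_of_tendsto_cofinite_zero
      (hu.comp (Prod.mk_right_injective k).tendsto_cofinite)
  refine ⟨fun k => ∑' i, v i k, ?_, fun k => ?_, fun x => ?_⟩
  · exact tendsto_cofinite_zero_of_rows hu fun k ε hε h => norm_hasSum_le (hrow k).hasSum hε.le h
  · exact norm_hasSum_le (hrow k).hasSum hC fun i => (hvR i k).trans (hRC i)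
  · have hsum : Summable fun q : (σ →₀ ℕ) × ι => monomialVal p K q.1 x * v q.2 q.1 := by
      refine NonarchimedeanAddGroup.summable_of_tendsto_cofinite_zero ?_
      rw [tendsto_zero_iff_norm_tendsto_zero] at hu ⊢
      exact squeeze_zero (fun _ => norm_nonneg _) (fun q => norm_monomialVal_mul_le _ _ _) hu
    obtain ⟨S, hS⟩ := hsum
    -- The double family is summed in both orders: by monomials here, by the functions `G i` in
    -- `h2`.
    have h1 := hS.prod_fiberwise fun k => (hrow k).hasSum.mul_left (monomialVal p K k x)
    have h2 := ((Equiv.prodComm ι (σ →₀ ℕ)).hasSum_iff.2 hS).prod_fiberwise fun i => hvs i x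
    rwa [h2.unique (hF x)] at h1

theorem tsum {ι : Type*} {G : ι → (σ → ℤ_[p]) → K} {R : ι → ℝ} {C : ℝ} (hC : 0 ≤ C)
    (hG : ∀ i, IsAnalyticLE p K (R i) (G i)) (hR : Tendsto R cofinite (𝓝 0))
    (hRC : ∀ i, R i ≤ C) : IsAnalyticLE p K C fun x => ∑' i, G i x :=
  hasSum hC hG hR hRC fun x => Summable.hasSum <|
    NonarchimedeanAddGroup.summable_of_tendsto_cofinite_zero <|
      tendsto_zero_iff_norm_tendsto_zero.2 <|
        squeeze_zero (fun _ => norm_nonneg _) (fun i => (hG i).norm_le x) hR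

/-- The product expands into the monomials v_k v'_l x^(k+l), and v_k v'_l tends to zero on pairs, so
`hasSum` applies without forming the coefficients of the Cauchy product. -/
theorem mul (h : IsAnalyticLE p K r F) (h' : IsAnalyticLE p K s F') :
    IsAnalyticLE p K (r * s) fun x => F x * F' x := by
  have := nonarchimedeanRing K
  have hr := h.nonneg
  have hs := h'.nonneg
  obtain ⟨v, h1, h2, h3⟩ := h
  obtain ⟨v', h1', h2', h3'⟩ := h'
  have hvv : Tendsto (fun q : (σ →₀ ℕ) × (σ →₀ ℕ) => v q.1 * v' q.2) cofinite (𝓝 0) :=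
    ((NonarchimedeanAddGroup.summable_of_tendsto_cofinite_zero h1).mul_of_nonarchimedean
      (NonarchimedeanAddGroup.summable_of_tendsto_cofinite_zero h1')).tendsto_cofinite_zero
  refine hasSum (mul_nonneg hr hs) (fun q : (σ →₀ ℕ) × (σ →₀ ℕ) =>
    monomial (q.1 + q.2) (v q.1 * v' q.2)) (tendsto_zero_iff_norm_tendsto_zero.1 hvv)
    (fun q => ?_) fun x => ?_
  · rw [norm_mul]
    exact mul_le_mul (h2 _) (h2' _) (norm_nonneg _) hr
  · convert (h3 x).mul_of_nonarchimedean (h3' x) using 2 with q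
    rw [monomialVal_add]
    ring

omit [CompleteSpace K] in
theorem add (h : IsAnalyticLE p K r F) (h' : IsAnalyticLE p K r F') :
    IsAnalyticLE p K r fun x => F x + F' x := by
  obtain ⟨v, h1, h2, h3⟩ := h
  obtain ⟨v', h1', h2', h3'⟩ := h'
  refine ⟨fun k => v k + v' k, by simpa using h1.add h1', fun k => ?_, fun x => ?_⟩
  · exact (IsUltrametricDist.norm_add_le_max _ _).trans (max_le (h2 k) (h2' k))
  · simpa only [mul_add] using (h3 x).add (h3' x)

theorem const_mul (a : K) (h : IsAnalyticLE p K r F) :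
    IsAnalyticLE p K (‖a‖ * r) fun x => a * F x :=
  (const a).mul h

theorem neg (h : IsAnalyticLE p K r F) : IsAnalyticLE p K r fun x => -F x := by
  simpa using const_mul (-1) h

theorem pow (h : IsAnalyticLE p K r F) (m : ℕ) : IsAnalyticLE p K (r ^ m) fun x => F x ^ m := by
  induction m with
  | zero => simpa using one
  | succ m ih => simpa only [pow_succ] using ih.mul h

theorem prod {ι : Type*} {S : Finset ι} {G : ι → (σ → ℤ_[p]) → K} {R : ι → ℝ}
    (h : ∀ i ∈ S, IsAnalyticLE p K (R i) (G i)) :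
    IsAnalyticLE p K (∏ i ∈ S, R i) fun x => ∏ i ∈ S, G i x := by
  classical
  induction S using Finset.induction_on with
  | empty => simpa using one
  | insert i S hi ih =>
    simp only [Finset.prod_insert hi]
    exact (h i (by simp)).mul (ih fun j hj => h j (by simp [hj]))

/-- Analytic functions may be composed with analytic maps of the polydisc. -/
theorem comp {F : (τ → ℤ_[p]) → K} (h : IsAnalyticLE p K r F) {y : τ → (σ → ℤ_[p]) → ℤ_[p]}
    (hy : ∀ i, IsAnalyticLE p K 1 fun x => algebraMap ℚ_[p] K (y i x)) :
    IsAnalyticLE p K r fun x => F fun i => y i x := by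
  have hr := h.nonneg
  obtain ⟨v, h1, h2, h3⟩ := h
  refine hasSum (R := fun k => ‖v k‖) hr (fun k => ?_) (tendsto_zero_iff_norm_tendsto_zero.1 h1) h2
    fun x => h3 fun i => y i x
  have hm : IsAnalyticLE p K 1 fun x => monomialVal p K k fun i => y i x := by
    have := prod (S := k.support) (R := fun _ => 1) fun i _ => by
      simpa using (hy i).pow (k i)
    simpa [monomialVal, Finsupp.prod] using this
  simpa using hm.mul (const (v k))

/-- Subtracting the value at 0 kills the constant term, and every other monomial contains some
coordinate, from which it gains at least one factor p^m. -/
theorem scale (h : IsAnalyticLE p K r F) (m : ℕ) :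
    IsAnalyticLE p K (r * ((p : ℝ)⁻¹) ^ m) fun x => F (fun i => (p : ℤ_[p]) ^ m * x i) - F 0 := by
  have hr := h.nonneg
  obtain ⟨v, h1, h2, h3⟩ := h
  have hp : (0 : ℝ) ≤ ((p : ℝ)⁻¹) ^ m := by positivity
  refine hasSum (R := fun k => ‖v k‖ * ((p : ℝ)⁻¹) ^ m) (mul_nonneg hr hp) (fun k => ?_) ?_
    (fun k => mul_le_mul_of_nonneg_right (h2 k) hp) fun x => (h3 _).sub (h3 0)
  · by_cases hk : k = 0
    · subst hk
      simpa using (const (p := p) (σ := σ) (0 : K)).mono (by simpa using by positivity)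
    · obtain ⟨i, hi⟩ := Finsupp.ne_iff.1 hk
      have hk' : k = Finsupp.single i 1 + (k - Finsupp.single i 1) := by
        rw [add_tsub_cancel_of_le]
        simpa [Nat.one_le_iff_ne_zero] using hi
      have h0 : monomialVal p K k (0 : σ → ℤ_[p]) = 0 := by
        rw [hk', monomialVal_add, monomialVal_single]
        simp
      have hc : ∀ x : σ → ℤ_[p], monomialVal p K k (fun i => (p : ℤ_[p]) ^ m * x i) =
          monomialVal p K k x * monomialVal p K k (fun _ => (p : ℤ_[p]) ^ m) := fun x => by
        simp only [monomialVal, ← map_mul, ← Finsupp.prod_mul, PadicInt.coe_mul, mul_pow]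
        congr 2
        ext
        rw [mul_comm]
      have hn : ‖monomialVal p K k (fun _ => (p : ℤ_[p]) ^ m)‖ ≤ ((p : ℝ)⁻¹) ^ m := by
        rw [hk', monomialVal_add, monomialVal_single, norm_mul]
        refine (mul_le_of_le_one_right (norm_nonneg _) (norm_monomialVal_le _ _)).trans ?_
        simp [norm_natCast_prime (p := p) (K := K)]
      simp only [h0, zero_mul, sub_zero, hc, mul_assoc]
      refine (monomial k _).mono ?_
      rw [norm_mul, mul_comm]
      exact mul_le_mul_of_nonneg_left hn (norm_nonneg _)
  · simpa using (tendsto_zero_iff_norm_tendsto_zero.1 h1).mul_const (((p : ℝ)⁻¹) ^ m)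

omit [CompleteSpace K] [IsUltrametricDist K] in
theorem map {F : (σ → ℤ_[p]) → ℚ_[p]} (h : IsAnalyticLE p ℚ_[p] r F) :
    IsAnalyticLE p K r fun x => algebraMap ℚ_[p] K (F x) := by
  obtain ⟨v, h1, h2, h3⟩ := h
  have hc : Continuous (algebraMap ℚ_[p] K) := continuous_algebraMap _ _
  refine ⟨fun k => algebraMap ℚ_[p] K (v k), ?_, fun k => ?_, fun x => ?_⟩
  · simpa [Function.comp_def] using (hc.tendsto 0).comp h1
  · simpa [norm_algebraMap'] using h2 k
  · convert (h3 x).map (algebraMap ℚ_[p] K) hc using 2 with k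
    simp [monomialVal]

end IsAnalyticLE

theorem IsGloballyAnalytic.exists_isAnalyticLE {F : (σ → ℤ_[p]) → K}
    (h : IsGloballyAnalytic p K F) : ∃ r, IsAnalyticLE p K r F := by
  obtain ⟨v, h1, h2⟩ := h
  obtain ⟨C, -, hC⟩ := exists_norm_le_of_tendsto_cofinite h1
  exact ⟨C, v, h1, hC, h2⟩

end AnalyticLE

/-! ### Logarithm and exponential of analytic functions. -/

section LogExp

variable {p : ℕ} [Fact p.Prime]

theorem norm_natCast_inv_eq (K : Type*) [NormedField K] [NormedAlgebra ℚ_[p] K] {m : ℕ}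
    (hm : m ≠ 0) : ‖(m : K)⁻¹‖ = (p : ℝ) ^ padicValNat p m := by
  rw [norm_inv, ← map_natCast (algebraMap ℚ_[p] K), norm_algebraMap',
    Padic.norm_eq_zpow_neg_valuation (Nat.cast_ne_zero.2 hm)]
  simp

theorem norm_natCast_inv_le (K : Type*) [NormedField K] [NormedAlgebra ℚ_[p] K] {m : ℕ}
    (hm : m ≠ 0) : ‖(m : K)⁻¹‖ ≤ m := by
  rw [norm_natCast_inv_eq (p := p) K hm]
  exact_mod_cast Nat.le_of_dvd (Nat.pos_of_ne_zero hm) pow_padicValNat_dvd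

/-- Legendre's formula: (p - 1) v_p(k!) is k minus the sum of the base p digits of k. -/
theorem norm_factorial_inv_le (K : Type*) [NormedField K] [NormedAlgebra ℚ_[p] K] (k : ℕ) :
    ‖(k.factorial : K)⁻¹‖ ≤ ((p : ℝ) ^ (1 / ((p : ℝ) - 1))) ^ k := by
  have hp1 : (1 : ℝ) < p := by exact_mod_cast (Fact.out : p.Prime).one_lt
  rw [norm_natCast_inv_eq (p := p) K k.factorial_ne_zero, ← Real.rpow_natCast,
    ← Real.rpow_natCast, ← Real.rpow_mul (by positivity)]
  refine Real.rpow_le_rpow_of_exponent_le hp1.le ?_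
  rw [one_div, inv_mul_eq_div, le_div_iff₀ (by linarith), mul_comm]
  have h1 : (p - 1) * padicValNat p k.factorial ≤ k := by
    rw [sub_one_mul_padicValNat_factorial]
    exact Nat.sub_le _ _
  have h2 : ((p - 1 : ℕ) : ℝ) = p - 1 := by
    rw [Nat.cast_sub (Fact.out : p.Prime).one_lt.le, Nat.cast_one]
  rw [← h2]
  exact_mod_cast h1

theorem succ_mul_inv_prime_pow_le (k : ℕ) : ((k : ℝ) + 1) * ((p : ℝ)⁻¹) ^ k ≤ 1 := by
  have hp0 : (0 : ℝ) < p := by exact_mod_cast (Fact.out : p.Prime).pos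
  rw [inv_pow, ← div_eq_mul_inv, div_le_one (by positivity)]
  exact_mod_cast Nat.succ_le_of_lt (Nat.lt_pow_self (Fact.out : p.Prime).one_lt)

theorem inv_prime_lt_one : ((p : ℝ)⁻¹) < 1 :=
  inv_lt_one_of_one_lt₀ (by exact_mod_cast (Fact.out : p.Prime).one_lt)

theorem summable_succ_mul_inv_prime_pow :
    Summable fun k : ℕ => ((k : ℝ) + 1) * ((p : ℝ)⁻¹) ^ k := by
  have h0 : ‖(p : ℝ)⁻¹‖ < 1 := by
    rw [Real.norm_of_nonneg (by positivity)]
    exact inv_prime_lt_one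
  have h1 := summable_pow_mul_geometric_of_norm_lt_one 1 h0
  have h2 := summable_geometric_of_norm_lt_one h0
  simpa [add_mul] using h1.add h2

/-- The crude estimate |1/(k+1)| ≤ k + 1 suffices: since m ≥ 1, the k-th term has norm at most
p^(-m) · (k+1) p^(-k), and (k+1) p^(-k) is at most 1 and tends to zero. -/
theorem IsAnalyticLE.padicLog {σ : Type*} {φ : (σ → ℤ_[p]) → ℤ_[p]} {m : ℕ} (hm : 1 ≤ m)
    (h : IsAnalyticLE p ℚ_[p] (((p : ℝ)⁻¹) ^ m) fun x => (φ x : ℚ_[p]) - 1) :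
    IsAnalyticLE p ℚ_[p] (((p : ℝ)⁻¹) ^ m) fun x => padicLog p (φ x) := by
  have hb : ∀ k : ℕ, (((p : ℝ)⁻¹) ^ m) ^ (k + 1) * ‖(((k + 1 : ℕ) : ℚ_[p]))⁻¹‖ ≤
      ((p : ℝ)⁻¹) ^ m * (((k : ℝ) + 1) * ((p : ℝ)⁻¹) ^ k) := fun k => by
    rw [pow_succ' _ k, mul_assoc, mul_comm ((k : ℝ) + 1)]
    gcongr
    · exact pow_le_of_le_one (by positivity) inv_prime_lt_one.le (by omega)
    · exact_mod_cast norm_natCast_inv_le (p := p) ℚ_[p] k.succ_ne_zero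
  refine IsAnalyticLE.tsum (R := fun k => (((p : ℝ)⁻¹) ^ m) ^ (k + 1) * ‖(((k + 1 : ℕ) : ℚ_[p]))⁻¹‖)
    (by positivity) (fun k => ?_) ?_ fun k => ?_
  · have := (h.pow (k + 1)).const_mul ((-1) ^ k * (((k + 1 : ℕ) : ℚ_[p]))⁻¹)
    rw [norm_mul, norm_pow, norm_neg, norm_one, one_pow, one_mul, mul_comm] at this
    convert this using 2 with x
    push_cast
    ring
  · refine squeeze_zero (fun k => by positivity) hb ?_
    simpa using ((summable_succ_mul_inv_prime_pow (p := p)).tendsto_cofinite_zero).const_mul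
      (((p : ℝ)⁻¹) ^ m)
  · exact (hb k).trans (mul_le_of_le_one_right (by positivity) (succ_mul_inv_prime_pow_le k))

theorem norm_padicLog_le {t : ℤ_[p]} (ht : (p : ℤ_[p]) ∣ t - 1) : ‖padicLog p t‖ ≤ (p : ℝ)⁻¹ := by
  -- The numerical estimate is the case of power series in no variables.
  have h : IsAnalyticLE p ℚ_[p] (((p : ℝ)⁻¹) ^ 1)
      fun _ : Empty → ℤ_[p] => (t : ℚ_[p]) - 1 := by
    refine (IsAnalyticLE.const _).mono ?_
    obtain ⟨s, hs⟩ := ht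
    rw [← PadicInt.coe_one, ← PadicInt.coe_sub, hs]
    simpa using mul_le_of_le_one_right (by positivity) s.2
  simpa using (h.padicLog le_rfl).norm_le 0

/-- The exponential series. -/
noncomputable def padicExp {K : Type*} [NormedField K] (z : K) : K :=
  ∑' k : ℕ, z ^ k / (k.factorial : K)

variable {K : Type*} [NormedField K] [NormedAlgebra ℚ_[p] K]

theorem padicPow_eq (t : ℤ_[p]) (c : K) :
    padicPow p t c = padicExp (c * algebraMap ℚ_[p] K (padicLog p t)) := rfl

theorem pow_mul_norm_factorial_inv_le {a : ℝ} (ha : 0 ≤ a) (k : ℕ) :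
    a ^ k * ‖(k.factorial : K)⁻¹‖ ≤ (a * (p : ℝ) ^ (1 / ((p : ℝ) - 1))) ^ k := by
  rw [mul_pow]
  exact mul_le_mul_of_nonneg_left (norm_factorial_inv_le K k) (by positivity)

theorem tendsto_pow_mul_norm_factorial_inv {a : ℝ} (ha : 0 ≤ a)
    (ha' : a * (p : ℝ) ^ (1 / ((p : ℝ) - 1)) < 1) :
    Tendsto (fun k : ℕ => a ^ k * ‖(k.factorial : K)⁻¹‖) cofinite (𝓝 0) := by
  refine squeeze_zero (fun k => by positivity) (pow_mul_norm_factorial_inv_le (p := p) ha) ?_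
  exact (summable_geometric_of_lt_one (by positivity) ha').tendsto_cofinite_zero

omit [NormedAlgebra ℚ_[p] K] in
/-- The bound on the exponents makes the exponential series converge. -/
theorem exponent_bound {c : K} (hc : ‖c‖ < (p : ℝ) ^ (1 - 1 / ((p : ℝ) - 1))) :
    ‖c‖ * (p : ℝ)⁻¹ * (p : ℝ) ^ (1 / ((p : ℝ) - 1)) < 1 := by
  have hp0 : (0 : ℝ) < p := by exact_mod_cast (Fact.out : p.Prime).pos
  rw [Real.rpow_sub hp0, Real.rpow_one, lt_div_iff₀ (by positivity)] at hc
  rw [mul_right_comm, ← div_eq_mul_inv, div_lt_one hp0]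
  exact hc

variable [CompleteSpace K] [IsUltrametricDist K]

theorem IsAnalyticLE.padicExp {σ : Type*} {F : (σ → ℤ_[p]) → K} {a : ℝ}
    (h : IsAnalyticLE p K a F) (ha' : a * (p : ℝ) ^ (1 / ((p : ℝ) - 1)) < 1) :
    IsAnalyticLE p K 1 fun x => WeylInd.padicExp (F x) := by
  change IsAnalyticLE p K 1 fun x => ∑' k : ℕ, F x ^ k / (k.factorial : K)
  have hR := tendsto_pow_mul_norm_factorial_inv (p := p) (K := K) h.nonneg ha'
  refine IsAnalyticLE.tsum zero_le_one (fun k => ?_) hR fun k => ?_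
  · have := (h.pow k).const_mul (k.factorial : K)⁻¹
    rw [mul_comm] at this
    simpa only [div_eq_inv_mul] using this
  · refine (pow_mul_norm_factorial_inv_le (p := p) h.nonneg k).trans ?_
    have := h.nonneg
    exact pow_le_one₀ (by positivity) ha'.le

/-- The Gauss norm of c log φ is at most |c|/p, which by `exponent_bound` is below the radius
p^(-1/(p-1)) of the exponential series. -/
theorem IsAnalyticLE.padicPow {σ : Type*} {φ : (σ → ℤ_[p]) → ℤ_[p]} {m : ℕ} (hm : 1 ≤ m)
    (h : IsAnalyticLE p ℚ_[p] (((p : ℝ)⁻¹) ^ m) fun x => (φ x : ℚ_[p]) - 1) {c : K}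
    (hc : ‖c‖ < (p : ℝ) ^ (1 - 1 / ((p : ℝ) - 1))) :
    IsAnalyticLE p K 1 fun x => padicPow p (φ x) c := by
  refine IsAnalyticLE.padicExp (a := ‖c‖ * (p : ℝ)⁻¹) ?_ (exponent_bound hc)
  have h1 := (h.padicLog hm).map (K := K)
  refine (h1.const_mul c).mono ?_
  gcongr
  exact pow_le_of_le_one (by positivity) inv_prime_lt_one.le (by omega)

theorem summable_padicExp {z : K} (hz : ‖z‖ * (p : ℝ) ^ (1 / ((p : ℝ) - 1)) < 1) :
    Summable fun k : ℕ => z ^ k / (k.factorial : K) := by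
  refine NonarchimedeanAddGroup.summable_of_tendsto_cofinite_zero
    (tendsto_zero_iff_norm_tendsto_zero.2 ?_)
  simpa [div_eq_mul_inv] using
    tendsto_pow_mul_norm_factorial_inv (p := p) (K := K) (norm_nonneg z) hz

/-- The binomial theorem identifies the terms with those of the Cauchy product, which converges
unconditionally in the ultrametric setting. -/
theorem padicExp_add {x y : K} (hx : ‖x‖ * (p : ℝ) ^ (1 / ((p : ℝ) - 1)) < 1)
    (hy : ‖y‖ * (p : ℝ) ^ (1 / ((p : ℝ) - 1)) < 1) :
    padicExp (x + y) = padicExp x * padicExp y := by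
  have := nonarchimedeanRing K
  have hchar : CharZero K := charZero_of_injective_algebraMap (algebraMap ℚ_[p] K).injective
  have hsx := summable_padicExp (p := p) hx
  have hsy := summable_padicExp (p := p) hy
  simp only [padicExp]
  have hsxy := hsx.mul_of_nonarchimedean hsy
  refine Eq.trans (tsum_congr fun k => ?_)
    (hsx.tsum_mul_tsum_eq_tsum_sum_antidiagonal hsy hsxy).symm
  rw [(Commute.all x y).add_pow', Finset.sum_div]
  refine Finset.sum_congr rfl fun q hq => ?_
  rw [← Finset.HasAntidiagonal.mem_antidiagonal.1 hq, nsmul_eq_mul, Nat.cast_add_choose]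
  have h1 : (q.1.factorial : K) ≠ 0 := Nat.cast_ne_zero.2 (Nat.factorial_ne_zero _)
  have h2 : (q.2.factorial : K) ≠ 0 := Nat.cast_ne_zero.2 (Nat.factorial_ne_zero _)
  have h3 : ((q.1 + q.2).factorial : K) ≠ 0 := Nat.cast_ne_zero.2 (Nat.factorial_ne_zero _)
  field_simp

theorem padicExp_nsmul {x : K} (hx : ‖x‖ * (p : ℝ) ^ (1 / ((p : ℝ) - 1)) < 1) (m : ℕ) :
    padicExp (m * x) = padicExp x ^ m := by
  induction m with
  | zero =>
    rw [Nat.cast_zero, zero_mul, pow_zero, padicExp, tsum_eq_single 0]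
    · simp
    · intro k hk; simp [hk]
  | succ m ih =>
    rw [Nat.cast_succ, add_mul, one_mul, padicExp_add (p := p) _ hx, ih, pow_succ]
    refine lt_of_le_of_lt ?_ hx
    gcongr
    rw [norm_mul]
    exact mul_le_of_le_one_left (norm_nonneg _) (IsUltrametricDist.norm_natCast_le_one K m)

end LogExp

/-! ### The logarithm as a limit, p-power roots of unity, and the character on 1 + pℤ_p. -/

section LogLimit

variable {p : ℕ} [Fact p.Prime]

theorem tendsto_natCast_prime_pow : Tendsto (fun N : ℕ => (p : ℚ_[p]) ^ N) atTop (𝓝 0) :=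
  tendsto_pow_atTop_nhds_zero_of_norm_lt_one (by rw [Padic.norm_p]; exact inv_prime_lt_one)

/-- p^N - 1 tends to -1 in ℚ_p, and binom(-1, k) = (-1)^k. The induction uses binom(q-1, k+1) = q
binom(q-1, k)/(k+1) - binom(q-1, k) with q = p^N, whose first term tends to zero. -/
theorem tendsto_choose_prime_pow_sub_one (k : ℕ) :
    Tendsto (fun N : ℕ => (((p ^ N - 1).choose k : ℕ) : ℚ_[p])) atTop (𝓝 ((-1) ^ k)) := by
  induction k with
  | zero => simp
  | succ k ih =>
    have h1 : ∀ N, (((p ^ N - 1).choose (k + 1) : ℕ) : ℚ_[p]) =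
        (p : ℚ_[p]) ^ N * ((p ^ N - 1).choose k : ℕ) / (k + 1 : ℕ) -
          ((p ^ N - 1).choose k : ℕ) := by
      intro N
      have hpos : p ^ N - 1 + 1 = p ^ N :=
        Nat.sub_add_cancel (Nat.one_le_pow _ _ (Fact.out : p.Prime).pos)
      have h2 := Nat.add_one_mul_choose_eq (p ^ N - 1) k
      rw [Nat.choose_succ_succ, hpos] at h2
      have h3 : ((k + 1 : ℕ) : ℚ_[p]) ≠ 0 := Nat.cast_ne_zero.2 k.succ_ne_zero
      rw [eq_sub_iff_add_eq, eq_div_iff h3]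
      rw [add_comm] at h2
      exact_mod_cast h2.symm
    simp only [h1]
    have h4 := ((tendsto_natCast_prime_pow (p := p)).mul ih).div_const ((k + 1 : ℕ) : ℚ_[p])
    simpa [pow_succ] using h4.sub ih

theorem norm_coe_sub_one_le {t : ℤ_[p]} (ht : (p : ℤ_[p]) ∣ t - 1) :
    ‖(t : ℚ_[p]) - 1‖ ≤ (p : ℝ)⁻¹ := by
  obtain ⟨s, hs⟩ := ht
  rw [← PadicInt.coe_one, ← PadicInt.coe_sub, hs]
  simpa using mul_le_of_le_one_right (by positivity) s.2

/-- `log t = lim (t^{p^N} - 1) / p^N`. -/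
theorem tendsto_padicLog {t : ℤ_[p]} (ht : (p : ℤ_[p]) ∣ t - 1) :
    Tendsto (fun N : ℕ => ((t : ℚ_[p]) ^ p ^ N - 1) / (p : ℚ_[p]) ^ N) atTop
      (𝓝 (padicLog p t)) := by
  have hs := norm_coe_sub_one_le ht
  set s := (t : ℚ_[p]) - 1 with hsdef
  have hp0 : (p : ℚ_[p]) ≠ 0 := Nat.cast_ne_zero.2 (Fact.out : p.Prime).ne_zero
  -- Writing binom(p^N, k+1) = p^N binom(p^N - 1, k)/(k+1) cancels the division by p^N and leaves
  -- coefficients that converge to those of the logarithm.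
  have h1 : ∀ N : ℕ, ((t : ℚ_[p]) ^ p ^ N - 1) / (p : ℚ_[p]) ^ N =
      ∑' k : ℕ, (((p ^ N - 1).choose k : ℕ) : ℚ_[p]) * s ^ (k + 1) / (k + 1 : ℕ) := by
    intro N
    have hpos : p ^ N - 1 + 1 = p ^ N :=
        Nat.sub_add_cancel (Nat.one_le_pow _ _ (Fact.out : p.Prime).pos)
    rw [tsum_eq_sum (s := Finset.range (p ^ N)) fun k hk => by
      rw [Nat.choose_eq_zero_of_lt, Nat.cast_zero, zero_mul, zero_div]
      rw [Finset.mem_range] at hk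
      omega]
    have ht' : (t : ℚ_[p]) = s + 1 := by rw [hsdef]; ring
    rw [ht', add_pow, Finset.sum_range_succ']
    simp only [one_pow, mul_one, pow_zero, Nat.choose_zero_right, Nat.cast_one,
      add_sub_cancel_right]
    rw [Finset.sum_div]
    refine Finset.sum_congr rfl fun k _ => ?_
    have h2 := Nat.add_one_mul_choose_eq (p ^ N - 1) k
    rw [hpos] at h2
    have h2' : (p : ℚ_[p]) ^ N * ((p ^ N - 1).choose k : ℕ) =
      ((p ^ N).choose (k + 1) : ℕ) * (k + 1 : ℕ) := by exact_mod_cast h2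
    have h3 : ((k + 1 : ℕ) : ℚ_[p]) ≠ 0 := Nat.cast_ne_zero.2 k.succ_ne_zero
    rw [div_eq_div_iff (pow_ne_zero _ hp0) h3]
    linear_combination (-s ^ (k + 1)) * h2'
  simp only [h1]
  refine tendsto_tsum_of_dominated_convergence
    ((summable_succ_mul_inv_prime_pow (p := p)).mul_right (p : ℝ)⁻¹) (fun k => ?_)
    (Eventually.of_forall fun N k => ?_)
  · have := ((tendsto_choose_prime_pow_sub_one (p := p) k).mul_const (s ^ (k + 1))).div_const
      ((k + 1 : ℕ) : ℚ_[p])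
    simpa using this
  · rw [div_eq_mul_inv, norm_mul, norm_mul, norm_pow, mul_comm]
    rw [mul_assoc ((k : ℝ) + 1), ← pow_succ]
    refine mul_le_mul ?_ ?_ (by positivity) (by positivity)
    · exact_mod_cast norm_natCast_inv_le (p := p) ℚ_[p] k.succ_ne_zero
    · calc _ ≤ 1 * ((p : ℝ)⁻¹) ^ (k + 1) := by
            gcongr
            exact IsUltrametricDist.norm_natCast_le_one _ _
        _ = _ := one_mul _

/-- In the limit formula, the sequence for t^(p^m) is p^m times the sequence for t shifted by m. -/
theorem padicLog_pow_prime_pow {t : ℤ_[p]} (ht : (p : ℤ_[p]) ∣ t - 1) (m : ℕ) :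
    padicLog p (t ^ p ^ m) = (p : ℚ_[p]) ^ m * padicLog p t := by
  have hp0 : (p : ℚ_[p]) ≠ 0 := Nat.cast_ne_zero.2 (Fact.out : p.Prime).ne_zero
  have ht' : (p : ℤ_[p]) ∣ t ^ p ^ m - 1 :=
    ht.trans (by simpa using sub_dvd_pow_sub_pow t 1 (p ^ m))
  have h1 := tendsto_padicLog ht'
  have h2 := ((tendsto_add_atTop_iff_nat m).2 (tendsto_padicLog ht)).const_mul ((p : ℚ_[p]) ^ m)
  refine tendsto_nhds_unique h1 (h2.congr fun N => ?_)
  rw [PadicInt.coe_pow, ← pow_mul, ← pow_add, add_comm m N, pow_add (p : ℚ_[p])]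
  field_simp

variable {K : Type*} [NormedField K] [NormedAlgebra ℚ_[p] K] [IsUltrametricDist K]

/-- The linear term pz strictly dominates. The terms of degree 2 to p - 1 carry a factor p from the
binomial coefficient and a further |z| ≤ 1/p. The last term satisfies |z|^p ≤ |z|^3 ≤ p^(-2) |z|,
which is where p = 2 fails. -/
theorem norm_one_add_pow_prime_sub_one (hp : 3 ≤ p) {z : K} (hz : ‖z‖ ≤ (p : ℝ)⁻¹) :
    ‖(1 + z) ^ p - 1‖ = (p : ℝ)⁻¹ * ‖z‖ := by
  have hp0 : (0 : ℝ) < p := by positivity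
  rcases eq_or_ne z 0 with rfl | hz0
  · simp
  have hzpos : 0 < ‖z‖ := norm_pos_iff.2 hz0
  have e : (1 + z) ^ p - 1 =
      (p : K) * z + ∑ k ∈ Finset.Ico 2 (p + 1), z ^ k * (p.choose k : K) := by
    rw [add_comm 1 z, add_pow]
    rw [Finset.range_eq_Ico, Finset.sum_eq_sum_Ico_succ_bot (by omega),
      Finset.sum_eq_sum_Ico_succ_bot (by omega)]
    simp
    ring
  have hlt : ‖∑ k ∈ Finset.Ico 2 (p + 1), z ^ k * (p.choose k : K)‖ < ‖(p : K) * z‖ := by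
    rw [norm_mul, norm_natCast_prime]
    refine lt_of_le_of_lt (IsUltrametricDist.norm_sum_le_of_forall_le_of_nonneg
      (C := ((p : ℝ)⁻¹) ^ 2 * ‖z‖) (by positivity) fun k hk => ?_) ?_
    · rw [Finset.mem_Ico] at hk
      rw [norm_mul, norm_pow]
      obtain ⟨j, rfl⟩ : ∃ j, k = j + 1 := ⟨k - 1, by omega⟩
      rcases lt_or_eq_of_le (Nat.lt_succ_iff.1 hk.2) with hk2 | hk2
      · obtain ⟨q, hq⟩ := (Fact.out : p.Prime).dvd_choose_self (by omega) hk2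
        rw [hq, Nat.cast_mul, norm_mul, norm_natCast_prime]
        have h1 : ‖z‖ ^ j ≤ (p : ℝ)⁻¹ :=
          (pow_le_of_le_one (norm_nonneg _) (hz.trans inv_prime_lt_one.le) (by omega)).trans hz
        have h2 := IsUltrametricDist.norm_natCast_le_one K q
        calc ‖z‖ ^ (j + 1) * ((p : ℝ)⁻¹ * ‖(q : K)‖) ≤ (p : ℝ)⁻¹ * ‖z‖ * ((p : ℝ)⁻¹ * 1) := by
              rw [pow_succ]; gcongr
          _ = _ := by ring
      · rw [hk2, Nat.choose_self, Nat.cast_one, norm_one, mul_one, ← hk2, pow_succ]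
        gcongr
        calc ‖z‖ ^ j ≤ ‖z‖ ^ 2 :=
              pow_le_pow_of_le_one (norm_nonneg _) (hz.trans inv_prime_lt_one.le) (by omega)
          _ ≤ _ := by
            gcongr
            rw [hk2]
            exact hz
    · rw [sq, mul_assoc]
      exact mul_lt_of_lt_one_left (by positivity) inv_prime_lt_one
  rw [e, IsUltrametricDist.norm_add_eq_max_of_norm_ne_norm hlt.ne', max_eq_left hlt.le, norm_mul,
    norm_natCast_prime]

omit [NormedAlgebra ℚ_[p] K] [IsUltrametricDist K] in
theorem IsUnramifiedOver.norm_le_inv (hK : IsUnramifiedOver p K) {z : K} (hz : ‖z‖ < 1) :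
    ‖z‖ ≤ (p : ℝ)⁻¹ := by
  rcases eq_or_ne z 0 with rfl | hz0
  · simp
  have hp1 : (1 : ℝ) < p := by exact_mod_cast (Fact.out : p.Prime).one_lt
  obtain ⟨m, hm⟩ := hK z hz0
  rw [hm, ← _root_.zpow_neg_one]
  rw [hm, zpow_lt_one_iff_right₀ hp1] at hz
  exact zpow_le_zpow_right₀ hp1.le (by omega)

/-- An unramified extension of `ℚ_p`, `p` odd, has no nontrivial `p`-power roots of unity. -/
theorem IsUnramifiedOver.eq_one_of_pow_eq_one (hK : IsUnramifiedOver p K) (hp : 3 ≤ p) {m : ℕ}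
    {ζ : K} (h : ζ ^ p ^ m = 1) : ζ = 1 := by
  have hone : ∀ ζ : K, ζ ^ p = 1 → ζ = 1 := by
    intro ζ h
    have hn : ‖ζ‖ = 1 := by
      have : ‖ζ‖ ^ p = 1 := by rw [← norm_pow, h, norm_one]
      exact (pow_eq_one_iff_of_nonneg (norm_nonneg _) (by omega)).1 this
    set z := ζ - 1 with hz
    have hz' : ζ = 1 + z := by rw [hz]; ring
    have hle : ‖z‖ ≤ 1 := by
      rw [hz, sub_eq_add_neg]
      exact (IsUltrametricDist.norm_add_le_max _ _).trans (by simp [hn])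
    -- In (1 + z)^p = 1 the terms of degree 1 to p - 1 are divisible by p, so |z|^p ≤ 1/p.
    have hlt : ‖z‖ < 1 := by
      have e : z ^ p = -∑ k ∈ Finset.Ico 1 p, z ^ k * (p.choose k : K) := by
        rw [hz', add_comm 1 z, add_pow, Finset.range_eq_Ico, Finset.sum_Ico_succ_top (by omega),
          Finset.sum_eq_sum_Ico_succ_bot (by omega)] at h
        simp only [one_pow, mul_one, pow_zero, Nat.choose_zero_right, Nat.cast_one,
          Nat.choose_self, zero_add] at h
        linear_combination h
      have : ‖z ^ p‖ ≤ (p : ℝ)⁻¹ := by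
        rw [e, norm_neg]
        refine IsUltrametricDist.norm_sum_le_of_forall_le_of_nonneg (by positivity) fun k hk => ?_
        rw [Finset.mem_Ico] at hk
        obtain ⟨q, hq⟩ := (Fact.out : p.Prime).dvd_choose_self (by omega) hk.2
        rw [norm_mul, norm_pow, hq, Nat.cast_mul, norm_mul, norm_natCast_prime]
        have h2 := IsUltrametricDist.norm_natCast_le_one K q
        calc ‖z‖ ^ k * ((p : ℝ)⁻¹ * ‖(q : K)‖) ≤ 1 * ((p : ℝ)⁻¹ * 1) := by
              gcongr
              exact pow_le_one₀ (norm_nonneg _) hle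
          _ = _ := by ring
      rw [norm_pow] at this
      by_contra hcon
      exact absurd (this.trans_lt inv_prime_lt_one) (not_lt.2 (one_le_pow₀ (not_lt.1 hcon)))
    -- Unramifiedness improves |z| < 1 to |z| ≤ 1/p; then 0 = |ζ^p - 1| = |z|/p.
    have h3 := norm_one_add_pow_prime_sub_one hp (hK.norm_le_inv hlt)
    rw [← hz', h, sub_self, norm_zero, eq_comm, mul_eq_zero, norm_eq_zero] at h3
    have : z = 0 := h3.resolve_left (by positivity)
    rw [hz', this, add_zero]
  induction m with
  | zero => simpa using h
  | succ m ih =>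
    rw [pow_succ, pow_mul] at h
    exact ih (hone _ h)

variable [CompleteSpace K]

/-- The character of an analytic weight is `t ^ c` on the whole of `1 + p ℤ_p`. -/
theorem IsAnalyticCharacter.eq_padicPow {n : ℕ} {χ : Fin n → (ℤ_[p]ˣ →* Kˣ)} {c : Fin n → K}
    (hχ : IsAnalyticCharacter p χ c) (hp : 3 ≤ p) (i : Fin n) {t : ℤ_[p]ˣ}
    (ht : (p : ℤ_[p]) ∣ (t : ℤ_[p]) - 1) : (χ i t : K) = padicPow p (t : ℤ_[p]) (c i) := by
  rcases hχ.unramified_or with hK | h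
  swap
  · exact h i t ht
  obtain ⟨m, hm⟩ := hχ.near_one i
  have hb : ‖c i * algebraMap ℚ_[p] K (padicLog p (t : ℤ_[p]))‖ *
      (p : ℝ) ^ (1 / ((p : ℝ) - 1)) < 1 := by
    refine lt_of_le_of_lt ?_ (exponent_bound (hχ.norm_lt i))
    rw [norm_mul, norm_algebraMap']
    gcongr
    exact norm_padicLog_le ht
  -- t^(p^m) is congruent to 1 modulo p^(m+1), hence close enough to 1 for the local identity. Thus
  -- the two sides for t differ by a p^m-th root of unity.
  have h1 : (χ i t : K) ^ p ^ m = padicPow p (t : ℤ_[p]) (c i) ^ p ^ m := by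
    have h2 := hm (t ^ p ^ m) (by
      have := dvd_sub_pow_of_dvd_sub (p := p) ht m
      rw [one_pow] at this
      rw [Units.val_pow_eq_pow_val]
      exact (pow_dvd_pow _ (Nat.le_succ m)).trans this)
    rw [map_pow, Units.val_pow_eq_pow_val, Units.val_pow_eq_pow_val] at h2
    rw [h2, padicPow_eq, padicPow_eq, ← padicExp_nsmul (p := p) hb, padicLog_pow_prime_pow ht]
    congr 1
    rw [map_mul, map_pow, map_natCast, Nat.cast_pow]
    ring
  have h0 : (χ i t : K) ≠ 0 := (χ i t).ne_zero
  have h3 : (padicPow p (t : ℤ_[p]) (c i) / (χ i t : K)) ^ p ^ m = 1 := by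
    rw [div_pow, ← h1, div_self (pow_ne_zero _ h0)]
  exact ((div_eq_one_iff_eq h0).1 (hK.eq_one_of_pow_eq_one hp h3)).symm

end LogLimit

/-! ### Uniqueness of power series coefficients. -/

section Uniqueness

theorem hasSum_ite_mem {ι E : Type*} [AddCommMonoid E] [TopologicalSpace E] [DecidableEq ι]
    (S : Finset ι) (f : ι → E) : HasSum (fun k => if k ∈ S then f k else 0) (∑ k ∈ S, f k) := by
  have := hasSum_sum_of_ne_finset_zero (L := SummationFilter.unconditional ι) (s := S)
    (f := fun k => if k ∈ S then f k else 0) fun k hk => if_neg hk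
  rwa [Finset.sum_congr rfl fun k hk => if_pos hk] at this

variable {p : ℕ} [Fact p.Prime] {K : Type*} [NormedField K] [NormedAlgebra ℚ_[p] K]
  {σ τ : Type*}

theorem monomialVal_const_mul (k : σ →₀ ℕ) (c : ℤ_[p]) (x : σ → ℤ_[p]) :
    monomialVal p K k (fun i => c * x i) =
      algebraMap ℚ_[p] K c ^ k.degree * monomialVal p K k x := by
  simp only [monomialVal, PadicInt.coe_mul, mul_pow]
  rw [Finsupp.prod_mul, map_mul, ← map_pow]
  congr 2
  rw [Finsupp.prod, Finset.prod_pow_eq_pow_sum, Finsupp.degree_apply]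

theorem finite_setOf_degree_eq [Finite σ] (d : ℕ) : {k : σ →₀ ℕ | k.degree = d}.Finite := by
  classical
  have := Fintype.ofFinite σ
  refine (Finset.finite_toSet (Finset.finsuppAntidiag (Finset.univ : Finset σ) d)).subset ?_
  intro k hk
  have hk' : k.degree = d := hk
  simp [← hk', Finsupp.degree_eq_sum]

variable [IsUltrametricDist K]

/-- The homogeneous part of lowest degree of a power series vanishing on the polydisc vanishes. -/
theorem sum_homogeneous_eq_zero {v : (σ →₀ ℕ) → K} (hv : Tendsto v cofinite (𝓝 0))
    (h : ∀ x : σ → ℤ_[p], HasSum (fun k => monomialVal p K k x * v k) 0) {d : ℕ}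
    (hd : ∀ k, k.degree < d → v k = 0) {S : Finset (σ →₀ ℕ)} (hS : ∀ k, k ∈ S ↔ k.degree = d)
    (x : σ → ℤ_[p]) : ∑ k ∈ S, monomialVal p K k x * v k = 0 := by
  classical
  obtain ⟨C, hC0, hC⟩ := exists_norm_le_of_tendsto_cofinite hv
  have hp0 : (p : K) ≠ 0 := by
    rw [← norm_pos_iff, norm_natCast_prime (p := p)]
    have := (Fact.out : p.Prime).pos
    positivity
  -- Evaluate at p^M x and divide by p^(Md): the part of degree d is unchanged and each term of
  -- higher degree keeps at least one factor p^M.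
  have key : ∀ M : ℕ, ‖∑ k ∈ S, monomialVal p K k x * v k‖ ≤ ((p : ℝ)⁻¹) ^ M * C := by
    intro M
    have h1 : HasSum (fun k => ((p : K) ^ M) ^ (k.degree - d) * (monomialVal p K k x * v k)) 0 := by
      have h2 := (h fun i => (p : ℤ_[p]) ^ M * x i).mul_left ((((p : K) ^ M) ^ d)⁻¹)
      rw [mul_zero] at h2
      refine (congrArg (HasSum · (0 : K)) (funext fun k => ?_)).mpr h2
      rcases lt_or_ge k.degree d with hk | hk
      · simp [hd k hk]
      · rw [monomialVal_const_mul]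
        have h4 : ((p : K) ^ M) ^ k.degree =
            ((p : K) ^ M) ^ d * ((p : K) ^ M) ^ (k.degree - d) := by
          rw [← pow_add, Nat.add_sub_cancel' hk]
        simp only [PadicInt.coe_pow, PadicInt.coe_natCast, map_pow, map_natCast]
        rw [h4]
        field_simp
    have h5 := hasSum_ite_mem S fun k => monomialVal p K k x * v k
    have h6 := h5.sub h1
    rw [sub_zero] at h6
    refine norm_hasSum_le h6 (by positivity) fun k => ?_
    by_cases hk : k ∈ S
    · rw [if_pos hk, (hS k).1 hk]
      simpa using by positivity
    · rw [if_neg hk, zero_sub, norm_neg, norm_mul, norm_pow, norm_pow,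
        norm_natCast_prime (p := p)]
      rcases lt_or_ge k.degree d with hk' | hk'
      · simpa [hd k hk'] using by positivity
      · have : k.degree ≠ d := fun e => hk ((hS k).2 e)
        refine mul_le_mul ?_ ((norm_monomialVal_mul_le _ _ _).trans (hC k)) (norm_nonneg _)
          (by positivity)
        exact pow_le_of_le_one (by positivity) (pow_le_one₀ (by positivity) inv_prime_lt_one.le)
          (by omega)
  have hlim : Tendsto (fun M : ℕ => ((p : ℝ)⁻¹) ^ M * C) atTop (𝓝 (0 * C)) :=
    (tendsto_pow_atTop_nhds_zero_of_lt_one (by positivity) inv_prime_lt_one).mul_const C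
  rw [zero_mul] at hlim
  exact norm_le_zero_iff.1 (ge_of_tendsto' hlim key)

/-- The coefficients of a convergent power series are determined by its values. -/
theorem eq_zero_of_hasSum_monomialVal [Finite σ] {v : (σ →₀ ℕ) → K}
    (hv : Tendsto v cofinite (𝓝 0))
    (h : ∀ x : σ → ℤ_[p], HasSum (fun k => monomialVal p K k x * v k) 0) : v = 0 := by
  classical
  by_contra hne
  have hex : ∃ d, ∃ k, k.degree = d ∧ v k ≠ 0 := by
    obtain ⟨k, hk⟩ := Function.ne_iff.1 hne
    exact ⟨_, k, rfl, hk⟩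
  obtain ⟨k₀, hk₀, hvk₀⟩ := Nat.find_spec hex
  have hmin : ∀ k, k.degree < Nat.find hex → v k = 0 := fun k hk => by
    by_contra hvk
    exact Nat.find_min hex hk ⟨k, rfl, hvk⟩
  have hS := finite_setOf_degree_eq (σ := σ) (Nat.find hex)
  have hz := sum_homogeneous_eq_zero hv h hmin (S := hS.toFinset) (by simp)
  -- With finitely many variables the lowest homogeneous part is a polynomial, and it vanishes on a
  -- product of copies of the infinite set ℤ_p.
  have hQ : ∑ k ∈ hS.toFinset, MvPolynomial.monomial k (v k) = (0 : MvPolynomial σ K) := by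
    refine MvPolynomial.funext_set (fun _ => Set.range fun t : ℤ_[p] => algebraMap ℚ_[p] K t)
      (fun _ => Set.infinite_range_of_injective
        ((algebraMap ℚ_[p] K).injective.comp Subtype.val_injective)) fun y hy => ?_
    choose x hx using fun i => hy i (Set.mem_univ i)
    rw [map_sum, map_zero]
    refine Eq.trans ?_ (hz x)
    refine Finset.sum_congr rfl fun k _ => ?_
    rw [MvPolynomial.eval_monomial, mul_comm, monomialVal, map_finsuppProd]
    congr 1
    refine Finsupp.prod_congr fun i _ => ?_
    rw [map_pow, ← hx i]
  have hc := congrArg (MvPolynomial.coeff k₀) hQ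
  rw [MvPolynomial.coeff_sum, MvPolynomial.coeff_zero] at hc
  simp only [MvPolynomial.coeff_monomial] at hc
  rw [Finset.sum_ite_eq' hS.toFinset k₀ v, if_pos (by simpa using hk₀)] at hc
  exact hvk₀ hc

end Uniqueness

/-! ### The Tate algebra as a normed space of functions, and separation of variables. -/

namespace TateSpace

variable {K : Type*} [NormedField K] {σ τ : Type*}

theorem ext {a b : TateSpace K σ} (h : ∀ k, a.coeff k = b.coeff k) : a = b :=
  Subtype.ext (lp.ext (funext h))

theorem tendsto_coeff (a : TateSpace K σ) : Tendsto a.coeff cofinite (𝓝 0) := a.2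

theorem norm_coeff_le (a : TateSpace K σ) (k : σ →₀ ℕ) : ‖a.coeff k‖ ≤ ‖a‖ :=
  lp.norm_apply_le_norm ENNReal.top_ne_zero a.1 k

theorem norm_le {a : TateSpace K σ} {C : ℝ} (hC : 0 ≤ C) (h : ∀ k, ‖a.coeff k‖ ≤ C) : ‖a‖ ≤ C :=
  lp.norm_le_of_forall_le hC h

theorem coeff_add (a b : TateSpace K σ) (k : σ →₀ ℕ) :
    (a + b).coeff k = a.coeff k + b.coeff k := rfl

theorem coeff_sub (a b : TateSpace K σ) (k : σ →₀ ℕ) :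
    (a - b).coeff k = a.coeff k - b.coeff k := rfl

theorem coeff_smul (c : K) (a : TateSpace K σ) (k : σ →₀ ℕ) :
    (c • a).coeff k = c * a.coeff k := rfl

theorem coeff_sum {ι : Type*} (S : Finset ι) (a : ι → TateSpace K σ) (k : σ →₀ ℕ) :
    (∑ i ∈ S, a i).coeff k = ∑ i ∈ S, (a i).coeff k := by
  classical
  induction S using Finset.induction_on with
  | empty => rfl
  | insert i S hi ih => rw [Finset.sum_insert hi, Finset.sum_insert hi, coeff_add, ih]

theorem exists_coeff_eq {v : (σ →₀ ℕ) → K} (hv : Tendsto v cofinite (𝓝 0)) :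
    ∃ a : TateSpace K σ, ∀ k, a.coeff k = v k := by
  have hb : Memℓp v ⊤ := by
    rw [memℓp_infty_iff]
    obtain ⟨C, -, hC⟩ := exists_norm_le_of_tendsto_cofinite hv
    exact ⟨C, by rintro _ ⟨k, rfl⟩; exact hC k⟩
  exact ⟨⟨⟨v, hb⟩, hv⟩, fun k => rfl⟩

variable {p : ℕ} [Fact p.Prime] [NormedAlgebra ℚ_[p] K]

/-- The function on the polydisc given by an element of the Tate algebra. -/
noncomputable def eval (p : ℕ) [Fact p.Prime] [NormedAlgebra ℚ_[p] K] (a : TateSpace K σ)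
    (x : σ → ℤ_[p]) : K :=
  ∑' k, monomialVal p K k x * a.coeff k

theorem exists_hasSum {r : ℝ} {F : (σ → ℤ_[p]) → K} (h : IsAnalyticLE p K r F) :
    ∃ a : TateSpace K σ, ‖a‖ ≤ r ∧
      ∀ x, HasSum (fun k => monomialVal p K k x * a.coeff k) (F x) := by
  have hr := h.nonneg
  obtain ⟨v, h1, h2, h3⟩ := h
  obtain ⟨a, ha⟩ := exists_coeff_eq h1
  refine ⟨a, norm_le hr fun k => ?_, ?_⟩
  · rw [ha]; exact h2 k
  · simpa only [ha] using h3

variable [IsUltrametricDist K]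

theorem eq_of_hasSum [Finite σ] {a b : TateSpace K σ} {F : (σ → ℤ_[p]) → K}
    (ha : ∀ x, HasSum (fun k => monomialVal p K k x * a.coeff k) (F x))
    (hb : ∀ x, HasSum (fun k => monomialVal p K k x * b.coeff k) (F x)) : a = b := by
  have h := eq_zero_of_hasSum_monomialVal (p := p) (a - b).tendsto_coeff fun x => by
    simpa only [coeff_sub, mul_sub, sub_self] using (ha x).sub (hb x)
  exact ext fun k => sub_eq_zero.1 ((coeff_sub a b k).symm.trans (congrFun h k))

variable [CompleteSpace K]

theorem hasSum_eval (a : TateSpace K σ) (x : σ → ℤ_[p]) :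
    HasSum (fun k => monomialVal p K k x * a.coeff k) (a.eval p x) := by
  refine (NonarchimedeanAddGroup.summable_of_tendsto_cofinite_zero ?_).hasSum
  have := a.tendsto_coeff
  rw [tendsto_zero_iff_norm_tendsto_zero] at this ⊢
  exact squeeze_zero (fun _ => norm_nonneg _) (fun k => norm_monomialVal_mul_le _ _ _) this

theorem isAnalyticLE_eval (a : TateSpace K σ) : IsAnalyticLE p K ‖a‖ (a.eval p) :=
  ⟨a.coeff, a.tendsto_coeff, a.norm_coeff_le, a.hasSum_eval⟩

theorem eval_add (a b : TateSpace K σ) (x : σ → ℤ_[p]) :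
    (a + b).eval p x = a.eval p x + b.eval p x := by
  refine ((a + b).hasSum_eval x).unique ?_
  simpa only [coeff_add, mul_add] using (a.hasSum_eval x).add (b.hasSum_eval x)

theorem eval_smul (c : K) (a : TateSpace K σ) (x : σ → ℤ_[p]) :
    (c • a).eval p x = c * a.eval p x := by
  refine ((c • a).hasSum_eval x).unique ?_
  simpa only [coeff_smul, mul_left_comm] using (a.hasSum_eval x).mul_left c

theorem eval_injective [Finite σ] : Function.Injective (eval p : TateSpace K σ → _ → K) :=
  fun a b h => eq_of_hasSum a.hasSum_eval (h ▸ b.hasSum_eval)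

/-- An analytic function of two groups of variables is an analytic function of the first one with
values in the Tate algebra of the second one. -/
theorem isGloballyAnalytic_of_joint [Finite τ] {r : ℝ}
    {F : (σ ⊕ τ → ℤ_[p]) → K} (hF : IsAnalyticLE p K r F) {A : (σ → ℤ_[p]) → TateSpace K τ}
    (hA : ∀ x y, (A x).eval p y = F (Sum.elim x y)) :
    IsGloballyAnalytic p K A ∧ ∀ x, ‖A x‖ ≤ r := by
  classical
  have hr := hF.nonneg
  obtain ⟨v, h1, h2, h3⟩ := hF
  set e := (Finsupp.sumFinsuppEquivProdFinsupp (α := σ) (β := τ) (γ := ℕ)).symm with he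
  have hu : Tendsto (fun q : (σ →₀ ℕ) × (τ →₀ ℕ) => v (e q)) cofinite (𝓝 0) :=
    h1.comp e.injective.tendsto_cofinite
  have hmono : ∀ (x : σ → ℤ_[p]) (y : τ → ℤ_[p]) q, monomialVal p K (e q) (Sum.elim x y) =
      monomialVal p K q.1 x * monomialVal p K q.2 y := fun x y q => by
    simp only [monomialVal, ← map_mul]
    congr 1
    exact Finsupp.prod_sumElim (f₁ := q.1) (f₂ := q.2)
      (g := fun i m => ((Sum.elim x y i : ℤ_[p]) : ℚ_[p]) ^ m)
  -- `V k` collects the coefficients of all monomials whose first component is x^k; it is a series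
  -- in the second group of variables.
  choose V hV using fun k => exists_coeff_eq (hu.comp (Prod.mk_right_injective k).tendsto_cofinite)
  have hcol : ∀ (x : σ → ℤ_[p]) (l : τ →₀ ℕ),
      Tendsto (fun k => monomialVal p K k x * v (e (k, l))) cofinite (𝓝 0) := fun x l => by
    have := hu.comp (Prod.mk_left_injective l).tendsto_cofinite
    rw [tendsto_zero_iff_norm_tendsto_zero] at this ⊢
    exact squeeze_zero (fun _ => norm_nonneg _) (fun k => norm_monomialVal_mul_le _ _ _) this
  have hcolsum := fun x l => NonarchimedeanAddGroup.summable_of_tendsto_cofinite_zero (hcol x l)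
  -- Summing over k first gives another power series in y with the values of `A x`, so uniqueness of
  -- coefficients identifies the two.
  have hcoeff : ∀ x l, HasSum (fun k => monomialVal p K k x * v (e (k, l))) ((A x).coeff l) := by
    intro x l
    have hB : Tendsto (fun l => ∑' k, monomialVal p K k x * v (e (k, l))) cofinite (𝓝 0) := by
      refine tendsto_cofinite_zero_of_rows (β := σ →₀ ℕ) (u := fun q => v (e (q.2, q.1)))
        (hu.comp (Equiv.prodComm _ _).injective.tendsto_cofinite) fun l ε hε hl => ?_
      exact norm_hasSum_le (hcolsum x l).hasSum hε.le fun k =>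
        (norm_monomialVal_mul_le _ _ _).trans (hl k)
    obtain ⟨b, hb⟩ := exists_coeff_eq hB
    have hAb : A x = b := by
      refine eq_of_hasSum (p := p) (A x).hasSum_eval fun y => ?_
      have h4 := (e.hasSum_iff.2 (h3 (Sum.elim x y)))
      have h5 := ((Equiv.prodComm (τ →₀ ℕ) (σ →₀ ℕ)).hasSum_iff.2 h4).prod_fiberwise fun l => by
        have := (hcolsum x l).hasSum.mul_left (monomialVal p K l y)
        refine (congrArg (HasSum · _) (funext fun k => ?_)).mpr this
        simp only [Function.comp_apply, Equiv.prodComm_apply, Prod.swap_prod_mk, hmono]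
        ring
      rw [hA]
      simpa only [hb] using h5
    rw [hAb, hb]
    exact (hcolsum x l).hasSum
  refine ⟨⟨V, ?_, fun x => ?_⟩, fun x => norm_le hr fun l => ?_⟩
  · refine tendsto_cofinite_zero_of_rows hu fun k ε hε hk => norm_le hε.le fun l => ?_
    rw [hV]
    exact hk l
  -- Convergence has to hold in the sup norm over l. It suffices that the partial sum contains the
  -- finitely many k for which some coefficient in row k exceeds ε/2.
  · rw [HasSum, SummationFilter.unconditional_filter, Metric.tendsto_atTop]
    intro ε hε
    have hfin := (tendsto_cofinite_zero_iff.1 hu (ε / 2) (half_pos hε)).image Prod.fst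
    refine ⟨hfin.toFinset, fun S hS => ?_⟩
    rw [dist_comm, dist_eq_norm]
    refine lt_of_le_of_lt (norm_le (half_pos hε).le fun l => ?_) (half_lt_self hε)
    have h6 := hasSum_ite_mem S fun k => monomialVal p K k x * v (e (k, l))
    have h7 := (hcoeff x l).sub h6
    have h8 : (A x - ∑ k ∈ S, monomialVal p K k x • V k).coeff l =
        (A x).coeff l - ∑ k ∈ S, monomialVal p K k x * v (e (k, l)) := by
      rw [coeff_sub, coeff_sum]
      simp only [coeff_smul, hV, Function.comp_apply]
    rw [h8]
    refine norm_hasSum_le h7 (half_pos hε).le fun k => ?_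
    by_cases hk : k ∈ S
    · simpa [hk] using (half_pos hε).le
    · rw [if_neg hk, sub_zero]
      refine (norm_monomialVal_mul_le _ _ _).trans ?_
      by_contra hcon
      refine hk (hS ?_)
      rw [Set.Finite.mem_toFinset]
      exact ⟨(k, l), not_le.1 hcon, rfl⟩
  · refine norm_hasSum_le (hcoeff x l) hr fun k => ?_
    exact (norm_monomialVal_mul_le _ _ _).trans (h2 _)

end TateSpace

/-! ### Gaussian elimination over a ring in which 1 + πa is always a unit. -/

section Decomposition

variable {R : Type*} [CommRing R]

theorem isUnit_add_mul {π : R} (hπ : ∀ a, IsUnit (1 + π * a)) {u : R} (hu : IsUnit u) (a : R) :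
    IsUnit (u + π * a) := by
  obtain ⟨u, rfl⟩ := hu
  convert u.isUnit.mul (hπ (↑u⁻¹ * a)) using 1
  linear_combination (-(π * a)) * u.mul_inv

/-- Factorization of a matrix with unit diagonal into a lower unipotent and an upper triangular
one, where the entries in the positions `(i, j)` with `r i < r j` are divisible by `π`. -/
theorem exists_lower_mul_upper {π : R} (hπ : ∀ a, IsUnit (1 + π * a)) {n : ℕ} (r : Fin n → ℕ)
    (hr : Function.Injective r) (N : Matrix (Fin n) (Fin n) R)
    (h0 : ∀ i j, r i < r j → π ∣ N i j) (h1 : ∀ i, IsUnit (N i i)) :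
    ∃ U B : Matrix (Fin n) (Fin n) R, U * B = N ∧ (∀ i, U i i = 1) ∧ (∀ i j, i < j → U i j = 0) ∧
      (∀ i j, r i < r j → π ∣ U i j) ∧ (∀ i j, j < i → B i j = 0) ∧ ∀ i, π ∣ B i i - N i i := by
  induction n with
  | zero => exact ⟨1, 1, Matrix.ext fun i => i.elim0, fun i => i.elim0, fun i => i.elim0,
      fun i => i.elim0, fun i => i.elim0, fun i => i.elim0⟩
  | succ n ih =>
    obtain ⟨u, hu⟩ := h1 0
    -- This lets the Schur complement of the pivot inherit the hypotheses. If r i < r 0, the entry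
    -- (i, 0) is divisible by π; otherwise r 0 ≤ r i ≤ r j, strict overall by injectivity, and the
    -- entry (0, j) is. For i = j it shows that the pivots change only modulo π.
    have hcorr : ∀ i j : Fin n, r i.succ ≤ r j.succ → π ∣ N i.succ 0 * ↑u⁻¹ * N 0 j.succ := by
      intro i j hij
      rcases lt_or_ge (r i.succ) (r 0) with h | h
      · exact dvd_mul_of_dvd_left (dvd_mul_of_dvd_left (h0 _ _ h) _) _
      · refine dvd_mul_of_dvd_right (h0 _ _ (lt_of_le_of_ne (h.trans hij) fun e => ?_)) _
        exact (Fin.succ_ne_zero j).symm (hr e)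
    obtain ⟨U, B, hUB, hU1, hU0, hUr, hB0, hB1⟩ := ih (fun i => r i.succ)
      (hr.comp (Fin.succ_injective n))
      (Matrix.of fun i j => N i.succ j.succ - N i.succ 0 * ↑u⁻¹ * N 0 j.succ)
      (fun i j hij => dvd_sub (h0 _ _ hij) (hcorr i j hij.le))
      (fun i => by
        obtain ⟨a, ha⟩ := hcorr i i le_rfl
        have := isUnit_add_mul hπ (h1 i.succ) (-a)
        rwa [mul_neg, ← ha, ← sub_eq_add_neg] at this)
    have huu : (↑u⁻¹ : R) * u = 1 := u.inv_mul
    refine ⟨Matrix.of fun i j => Fin.cases (motive := fun _ => R)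
        (Fin.cases (motive := fun _ => R) 1 (fun _ => 0) j)
        (fun i => Fin.cases (motive := fun _ => R) (N i.succ 0 * ↑u⁻¹) (fun j => U i j) j) i,
      Matrix.of fun i j => Fin.cases (motive := fun _ => R) (N 0 j)
        (fun i => Fin.cases (motive := fun _ => R) 0 (fun j => B i j) j) i, ?_, ?_, ?_, ?_, ?_, ?_⟩
    · ext1 i j
      rw [Matrix.mul_apply, Fin.sum_univ_succ]
      refine Fin.cases ?_ (fun i => ?_) i
      · simp
      · refine Fin.cases ?_ (fun j => ?_) j
        · simp [← hu, mul_assoc]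
        · have := congrFun (congrFun hUB i) j
          simp only [Matrix.mul_apply, Matrix.of_apply] at this
          simp [this]
    · intro i
      refine Fin.cases ?_ (fun i => ?_) i
      · simp
      · simpa using hU1 i
    · intro i j
      refine Fin.cases ?_ (fun i => ?_) i <;> refine Fin.cases ?_ (fun j => ?_) j
      · simp
      · simp
      · simp
      · simpa using hU0 i j
    · intro i j
      refine Fin.cases ?_ (fun i => ?_) i <;> refine Fin.cases ?_ (fun j => ?_) j
      · simp
      · simp
      · intro h
        simpa using dvd_mul_of_dvd_left (h0 _ _ h) (↑u⁻¹ : R)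
      · simpa using hUr i j
    · intro i j
      refine Fin.cases ?_ (fun i => ?_) i <;> refine Fin.cases ?_ (fun j => ?_) j
      · simp
      · simp
      · simp
      · simpa using hB0 i j
    · intro i
      refine Fin.cases ?_ (fun i => ?_) i
      · simp
      · have h2 := dvd_sub (hB1 i) (hcorr i i le_rfl)
        simp only [Matrix.of_apply, Fin.cases_succ] at h2 ⊢
        convert h2 using 1
        ring

variable {n : ℕ} (w : Equiv.Perm (Fin n))

/-- The matrix in `w U w⁻¹` with entries `x_{ij}` for `i > j` and `π x_{ij}` for `i < j`. -/
def unipMatrix (π : R) (x : WeylIdx w → R) : Matrix (Fin n) (Fin n) R :=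
  Matrix.of fun i j =>
    if h : w⁻¹ j < w⁻¹ i then (if i < j then π else 1) * x ⟨(i, j), h⟩ else if i = j then 1 else 0

theorem unipMatrix_map {S : Type*} [CommRing S] (e : R →+* S) (π : R) (x : WeylIdx w → R) :
    e.mapMatrix (unipMatrix w π x) = unipMatrix w (e π) fun q => e (x q) := by
  ext i j
  simp only [RingHom.mapMatrix_apply, Matrix.map_apply, unipMatrix, Matrix.of_apply]
  split_ifs <;> simp

/-- Reindexing by w turns wUw⁻¹ into lower unipotent matrices, while the divisibility condition i <
j becomes w i < w j. This is why the elimination allows a ranking `r`, here taken to be w. -/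
theorem exists_unipMatrix_mul_upper {π : R} (hπ : ∀ a, IsUnit (1 + π * a))
    (M : Matrix (Fin n) (Fin n) R) (h0 : ∀ i j, i < j → π ∣ M i j) (h1 : ∀ i, IsUnit (M i i)) :
    ∃ (y : WeylIdx w → R) (B : Matrix (Fin n) (Fin n) R),
      (unipMatrix w π y).submatrix w w * B = M.submatrix w w ∧ (∀ i j, j < i → B i j = 0) ∧
      ∀ i, π ∣ B i i - M (w i) (w i) := by
  obtain ⟨U, B, hUB, hU1, hU0, hUr, hB0, hB1⟩ := exists_lower_mul_upper hπ
    (fun i => (w i : ℕ)) (Fin.val_injective.comp w.injective) (M.submatrix w w)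
    (fun i j hij => h0 _ _ hij) fun i => h1 _
  have hy : ∀ q : WeylIdx w, ∃ z : R,
      U (w⁻¹ q.1.1) (w⁻¹ q.1.2) = (if q.1.1 < q.1.2 then π else 1) * z := by
    intro q
    split_ifs with h
    · exact hUr _ _ (by simpa using h)
    · exact ⟨_, (one_mul _).symm⟩
  choose y hy using hy
  refine ⟨y, B, ?_, hB0, hB1⟩
  rw [← hUB]
  congr 1
  ext i j
  simp only [Matrix.submatrix_apply, unipMatrix, Matrix.of_apply]
  split_ifs with h1 h2 h3
  · rw [← show π * y ⟨(w i, w j), h1⟩ = U i j by simpa [h2] using (hy ⟨(w i, w j), h1⟩).symm]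
  · simpa [h2] using (hy ⟨(w i, w j), h1⟩).symm
  · rw [w.injective h3, hU1]
  · refine (hU0 i j (lt_of_le_of_ne ?_ fun e => h3 (by rw [e]))).symm
    simpa using h1

end Decomposition

/-! ### The factorization B = (wUw⁻¹ ∩ B) P_w^+ and values of equivariant functions. -/

section Factorization

variable {p n : ℕ} [Fact p.Prime] {w : Equiv.Perm (Fin n)}

theorem weylGL_inv_conj_apply {R : Type*} [CommRing R] (w : Equiv.Perm (Fin n))
    (g : GL (Fin n) R) (i j : Fin n) :
    ((weylGL n R w)⁻¹ * g * weylGL n R w) i j = g (w i) (w j) := by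
  have := weylGL_conj_apply w ((weylGL n R w)⁻¹ * g * weylGL n R w) (w i) (w j)
  simpa [mul_assoc] using this.symm

/-- Both g and g⁻¹ are lower triangular modulo p, so their i-th diagonal entries multiply to 1
modulo p. -/
theorem isUnit_iwahori_diag (g : iwahori p n) (i : Fin n) : IsUnit (g.1 i i) := by
  have h := lower_mul_diag (a := (redGL p n g.1).1) (b := (redGL p n g.1⁻¹).1) g.2
    (g⁻¹).2 i
  rw [← Units.val_mul, ← map_mul, mul_inv_cancel, map_one] at h
  have h1 : PadicInt.toZMod (g.1 i i * g.1⁻¹ i i - 1) = 0 := by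
    rw [map_sub, map_mul, map_one, sub_eq_zero]
    refine h.symm.trans ?_
    simp
  obtain ⟨a, ha⟩ := (toZMod_eq_zero_iff p).1 h1
  have h2 := isUnit_one_add_p_mul p a
  rw [← ha, add_sub_cancel] at h2
  exact isUnit_of_mul_isUnit_left h2

theorem weylMat_eq_unipMatrix (x : WeylIdx w → ℤ_[p]) :
    weylMat p n w x = unipMatrix w (p : ℤ_[p]) x := rfl

theorem weylBorel_apply_eq_zero (b : weylBorel p n w) {i j : Fin n} (hij : j < i) :
    b.1 (w i) (w j) = 0 := by
  obtain ⟨_, -, u, hu, rfl⟩ := b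
  refine (weylGL_conj_apply w u (w i) (w j)).trans ?_
  simpa using hu (by simpa using hij)

theorem eq_one_of_mem_weylUnip_of_mem_weylBorel {z : GL (Fin n) ℤ_[p]}
    (hz : z ∈ weylUnip p n w) (hz' : z ∈ weylBorel p n w) : z = 1 := by
  obtain ⟨-, h0, h1⟩ := (mem_weylUnip p n).1 hz
  refine Units.ext (Matrix.ext fun i j => ?_)
  rcases lt_trichotomy (w⁻¹ i) (w⁻¹ j) with h | h | h
  · have : i ≠ j := by rintro rfl; exact lt_irrefl _ h
    rw [h0 _ _ h]
    simp [this]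
  · obtain rfl := (w⁻¹).injective h
    rw [h1]
    simp
  · have hne : i ≠ j := by rintro rfl; exact lt_irrefl _ h
    have := weylBorel_apply_eq_zero ⟨z, hz'⟩ h
    rw [show w (w⁻¹ i) = i by simp, show w (w⁻¹ j) = j by simp] at this
    rw [this]
    simp [hne]

theorem weylPoint_mul_inj {y y' : WeylIdx w → ℤ_[p]} {b b' : weylBorel p n w}
    (h : (weylPoint w y : iwahori p n) * Subgroup.inclusion inf_le_left b =
      weylPoint w y' * Subgroup.inclusion inf_le_left b') : y = y' ∧ b = b' := by
  have h' : (weylChart p n w y).1 * b.1 = (weylChart p n w y').1 * b'.1 := congrArg Subtype.val h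
  have h1 : (weylChart p n w y').1⁻¹ * (weylChart p n w y).1 = b'.1 * b.1⁻¹ := by
    rw [eq_mul_inv_iff_mul_eq, mul_assoc, inv_mul_eq_iff_eq_mul, h']
  have h2 := eq_one_of_mem_weylUnip_of_mem_weylBorel (w := w)
    (mul_mem (inv_mem (weylChart p n w y').2) (weylChart p n w y).2)
    (h1 ▸ mul_mem b'.2 (inv_mem b.2))
  have h3 : (weylChart p n w y').1 = (weylChart p n w y).1 := inv_mul_eq_one.1 h2
  refine ⟨(weylChart p n w).injective (Subtype.ext h3.symm), Subtype.ext ?_⟩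
  rw [h3] at h'
  exact mul_left_cancel h'

/-- Turns a factorization of matrices into one in the group. The second factor is the quotient of
two elements of B, and after conjugation by w it equals the triangular matrix `B`, because the
unipotent factor can be cancelled. -/
theorem exists_eq_weylPoint_mul {g : iwahori p n} {y : WeylIdx w → ℤ_[p]}
    {B : Matrix (Fin n) (Fin n) ℤ_[p]}
    (h : (weylMat p n w y).submatrix w w * B = (g.1 : Matrix _ _ ℤ_[p]).submatrix w w)
    (hB : ∀ i j, j < i → B i j = 0) :
    ∃ b : weylBorel p n w, g = weylPoint w y * Subgroup.inclusion inf_le_left b ∧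
      ∀ i, b.1 (w i) (w i) = B i i := by
  set z : iwahori p n := (weylPoint w y)⁻¹ * g with hz
  have hg : weylPoint w y * z = g := by rw [hz, mul_inv_cancel_left]
  have hzB : (z.1 : Matrix _ _ ℤ_[p]).submatrix w w = B := by
    have h1 : (weylMat p n w y).submatrix w w * (z.1 : Matrix _ _ ℤ_[p]).submatrix w w =
        (weylMat p n w y).submatrix w w * B := by
      rw [h, Matrix.submatrix_mul_equiv, ← hg]
      rfl
    have hdet : IsUnit ((weylMat p n w y).submatrix w w) := by
      rw [Matrix.isUnit_iff_isUnit_det, Matrix.det_submatrix_equiv_self, det_weylMat]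
      exact isUnit_one
    exact hdet.mul_left_cancel h1
  have hmem : z.1 ∈ weylBorel p n w := by
    refine ⟨z.2, (weylGL n ℤ_[p] w)⁻¹ * z.1 * weylGL n ℤ_[p] w, fun i j hij => ?_, ?_⟩
    · rw [weylGL_inv_conj_apply]
      exact (congrFun (congrFun hzB i) j).trans (hB i j (by simpa using hij))
    · simp [mul_assoc]
  exact ⟨⟨z.1, hmem⟩, hg.symm, fun i => congrFun (congrFun hzB i) i⟩

/-- `B = (w U w⁻¹ ∩ B) P_w^+`. -/
theorem exists_weylPoint_mul (w : Equiv.Perm (Fin n)) (g : iwahori p n) :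
    ∃ (y : WeylIdx w → ℤ_[p]) (b : weylBorel p n w),
      g = weylPoint w y * Subgroup.inclusion inf_le_left b := by
  have h1 : ∀ i, IsUnit (g.1 i i) := isUnit_iwahori_diag g
  obtain ⟨y, B, h, hB, -⟩ := exists_unipMatrix_mul_upper w (isUnit_one_add_p_mul p) g.1.1
    ((mem_iwahori p n).1 g.2) h1
  obtain ⟨b, hb, -⟩ := exists_eq_weylPoint_mul (g := g) h hB
  exact ⟨y, b, hb⟩

theorem weylChar_eq_prod {M : Type*} [CommGroup M] (χ : Fin n → (ℤ_[p]ˣ →* M))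
    (b : weylBorel p n w) {β : Fin n → ℤ_[p]ˣ} (hβ : ∀ i, (β i : ℤ_[p]) = b.1 (w i) (w i)) :
    weylChar χ w b = ∏ i, χ i (β i) := by
  rw [weylChar, MonoidHom.comp_apply, borelChar, MonoidHom.finsetProd_apply]
  refine Finset.prod_congr rfl fun i _ => ?_
  simp only [MonoidHom.comp_apply, Pi.evalMonoidHom_apply]
  congr 1
  refine Units.ext ?_
  rw [hβ]
  change (((weylGL n ℤ_[p] w)⁻¹ * b.1 * (weylGL n ℤ_[p] w)⁻¹⁻¹ : GL (Fin n) ℤ_[p])) i i = _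
  rw [inv_inv, weylGL_inv_conj_apply]

variable {K : Type*} [NormedField K]

/-- Stated for a bare matrix identity, so that it applies to any specialization of a factorization
found over a ring of functions. -/
theorem apply_eq_of_decomposition {χ : Fin n → (ℤ_[p]ˣ →* Kˣ)} {f : iwahori p n → K}
    (hf : ∀ (g : iwahori p n) (b : weylBorel p n w),
      f (g * Subgroup.inclusion inf_le_left b) = (weylChar χ w b⁻¹ : Kˣ) * f g)
    {g : iwahori p n} {y : WeylIdx w → ℤ_[p]} {B : Matrix (Fin n) (Fin n) ℤ_[p]}
    (h : (weylMat p n w y).submatrix w w * B = (g.1 : Matrix _ _ ℤ_[p]).submatrix w w)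
    (hB : ∀ i j, j < i → B i j = 0) {β : Fin n → ℤ_[p]ˣ} (hβ : ∀ i, (β i : ℤ_[p]) = B i i) :
    f g = (∏ i, (χ i (β i)⁻¹ : K)) * f (weylPoint w y) := by
  obtain ⟨b, hb, hbB⟩ := exists_eq_weylPoint_mul h hB
  have hχ := weylChar_eq_prod χ b (β := β) fun i => (hβ i).trans (hbB i).symm
  rw [hb, hf, map_inv, hχ, ← Finset.prod_inv_distrib, Units.coe_prod]
  simp only [map_inv]

end Factorization

/-! ### The ring of integral analytic functions. -/

section IntegralAnalytic

variable (p : ℕ) [Fact p.Prime] (σ : Type*)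

/-- The ring of `ℤ_p`-valued functions on the polydisc given by power series with coefficients in
`ℤ_p` tending to zero. -/
def integralAnalytic : Subring ((σ → ℤ_[p]) → ℤ_[p]) where
  carrier := {φ | IsAnalyticLE p ℚ_[p] 1 fun x => (φ x : ℚ_[p])}
  mul_mem' ha hb := by simpa using IsAnalyticLE.mul ha hb
  one_mem' := by simpa using IsAnalyticLE.one
  add_mem' ha hb := by simpa using IsAnalyticLE.add ha hb
  zero_mem' := by
    simpa using (IsAnalyticLE.const (p := p) (σ := σ) (0 : ℚ_[p])).mono (s := 1) (by simp)
  neg_mem' ha := by simpa using IsAnalyticLE.neg ha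

namespace integralAnalytic

variable {p σ}

/-- Constants. -/
noncomputable def const (t : ℤ_[p]) : integralAnalytic p σ :=
  ⟨fun _ => t, (IsAnalyticLE.const (t : ℚ_[p])).mono t.2⟩

/-- Coordinate functions. -/
noncomputable def coord (i : σ) : integralAnalytic p σ := ⟨fun x => x i, IsAnalyticLE.coord i⟩

/-- Evaluation at a point. -/
noncomputable def evalAt (x : σ → ℤ_[p]) : integralAnalytic p σ →+* ℤ_[p] :=
  (Pi.evalRingHom (fun _ : σ → ℤ_[p] => ℤ_[p]) x).comp (integralAnalytic p σ).subtype

theorem isAnalyticLE (φ : integralAnalytic p σ) (K : Type*) [NormedField K]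
    [NormedAlgebra ℚ_[p] K] : IsAnalyticLE p K 1 fun x => algebraMap ℚ_[p] K (evalAt x φ) :=
  IsAnalyticLE.map φ.2

/-- The pointwise inverse is the geometric series in -pφ, whose k-th term has Gauss norm at most
p^(-k). This is the hypothesis under which elimination works over the function ring. -/
theorem isUnit_one_add_mul (φ : integralAnalytic p σ) :
    IsUnit (1 + (p : integralAnalytic p σ) * φ) := by
  choose u hu using fun x : σ → ℤ_[p] => isUnit_one_add_p_mul p (φ.1 x)
  have hmem : IsAnalyticLE p ℚ_[p] 1 fun x => (((u x)⁻¹ : ℤ_[p]ˣ) : ℤ_[p] ) := by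
    refine IsAnalyticLE.hasSum (G := fun (k : ℕ) x => (-(p : ℚ_[p]) * (φ.1 x : ℚ_[p])) ^ k)
      (R := fun k => ((p : ℝ)⁻¹) ^ k) zero_le_one (fun k => ?_)
      (summable_geometric_of_lt_one (by positivity) inv_prime_lt_one).tendsto_cofinite_zero
      (fun k => pow_le_one₀ (by positivity) inv_prime_lt_one.le) fun x => ?_
    · have := (IsAnalyticLE.const_mul (-(p : ℚ_[p])) φ.2).pow k
      simpa using this
    · have hn : ‖-(p : ℚ_[p]) * (φ.1 x : ℚ_[p])‖ < 1 := by
        rw [norm_mul, norm_neg, Padic.norm_p]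
        exact (mul_le_of_le_one_right (by positivity) (φ.1 x).2).trans_lt inv_prime_lt_one
      have h1 := hasSum_geometric_of_norm_lt_one hn
      have h2 : (1 - -(p : ℚ_[p]) * (φ.1 x : ℚ_[p]))⁻¹ = (((u x)⁻¹ : ℤ_[p]ˣ) : ℤ_[p]) := by
        refine inv_eq_of_mul_eq_one_left ?_
        have h3 : (((u x)⁻¹ : ℤ_[p]ˣ) : ℤ_[p]) * (1 + p * φ.1 x) = 1 := by
          rw [← hu, Units.inv_mul]
        have h4 := congrArg (fun t : ℤ_[p] => (t : ℚ_[p])) h3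
        push_cast at h4
        linear_combination h4
      rwa [h2] at h1
  refine IsUnit.of_mul_eq_one ⟨fun x => (((u x)⁻¹ : ℤ_[p]ˣ) : ℤ_[p]), hmem⟩ ?_
  refine Subtype.ext (funext fun x => ?_)
  have h3 : (1 + p * φ.1 x) * (((u x)⁻¹ : ℤ_[p]ˣ) : ℤ_[p]) = 1 := by rw [← hu, Units.mul_inv]
  simpa using h3

end integralAnalytic

end IntegralAnalytic

/-! ### Characters evaluated on families of units. -/

section Characters

open integralAnalytic

variable {p : ℕ} [Fact p.Prime] {σ : Type*} {K : Type*} [NormedField K] [NormedAlgebra ℚ_[p] K]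
  [CompleteSpace K] [IsUltrametricDist K] {n : ℕ} {χ : Fin n → (ℤ_[p]ˣ →* Kˣ)} {c : Fin n → K}

/-- The congruence holds in the function ring, so γ - 1 has Gauss norm at most 1/p and the estimates
for exp(c log γ) apply on the entire polydisc. -/
theorem IsAnalyticCharacter.isAnalyticLE (hχ : IsAnalyticCharacter p χ c) (hp : n + 1 < p)
    (i : Fin n) {γ : (integralAnalytic p σ)ˣ} (hγ : (p : integralAnalytic p σ) ∣ γ - 1) :
    IsAnalyticLE p K 1 fun x => (χ i (Units.map (evalAt x).toMonoidHom γ) : K) := by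
  -- An index `i` exists only if n ≥ 1, so the hypothesis on p excludes 2.
  have hp3 : 3 ≤ p := by have := i.pos; omega
  obtain ⟨δ, hδ⟩ := hγ
  have hx : ∀ x, evalAt x γ.1 - 1 = p * evalAt x δ := fun x => by
    rw [← map_one (evalAt x), ← map_sub, hδ, map_mul, map_natCast]
  have h1 : IsAnalyticLE p ℚ_[p] (((p : ℝ)⁻¹) ^ 1)
      fun x => ((evalAt x γ.1 : ℤ_[p]) : ℚ_[p]) - 1 := by
    have h2 := (integralAnalytic.isAnalyticLE δ ℚ_[p]).const_mul (p : ℚ_[p])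
    rw [Padic.norm_p, mul_one] at h2
    rw [pow_one]
    convert h2 using 2 with x
    have := congrArg (fun t : ℤ_[p] => (t : ℚ_[p])) (hx x)
    simpa using this
  convert h1.padicPow le_rfl (hχ.norm_lt i) using 2 with x
  exact hχ.eq_padicPow hp3 i ⟨_, hx x⟩

/-- For a unit not assumed congruent to 1, split off the constant χ(γ(0)). On a ball of radius
p^(-M) the quotient γ(0)⁻¹ γ lies in 1 + p^M ℤ_p, where the identity near 1 applies. `M₀` is m + 1
so that also M ≥ 1, as the logarithm requires. -/
theorem IsAnalyticCharacter.exists_isAnalyticLE_scale (hχ : IsAnalyticCharacter p χ c) (i : Fin n)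
    (γ : (integralAnalytic p σ)ˣ) : ∃ M₀ : ℕ, ∀ M ≥ M₀, ∃ r, IsAnalyticLE p K r fun x =>
      (χ i (Units.map (evalAt fun j => (p : ℤ_[p]) ^ M * x j).toMonoidHom γ) : K) := by
  obtain ⟨m, hm⟩ := hχ.near_one i
  refine ⟨m + 1, fun M hM => ?_⟩
  set u : (σ → ℤ_[p]) → ℤ_[p]ˣ := fun x => Units.map (evalAt x).toMonoidHom γ with hu
  have hu' : ∀ x, (u x : ℤ_[p]) = γ.1.1 x := fun x => rfl
  have h1 : IsAnalyticLE p ℚ_[p] (((p : ℝ)⁻¹) ^ M) fun x =>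
      ((((u 0)⁻¹ * u fun j => (p : ℤ_[p]) ^ M * x j : ℤ_[p]ˣ) : ℤ_[p]) : ℚ_[p]) - 1 := by
    have h2 := (IsAnalyticLE.scale γ.1.2 M).const_mul
      ((((u 0)⁻¹ : ℤ_[p]ˣ) : ℤ_[p]) : ℚ_[p])
    convert h2.mono (s := ((p : ℝ)⁻¹) ^ M) ?_ using 2 with x
    · have h3 : ((((u 0)⁻¹ : ℤ_[p]ˣ) : ℤ_[p]) : ℚ_[p]) * (γ.1.1 0 : ℤ_[p]) = 1 := by
        rw [← hu', ← PadicInt.coe_mul, Units.inv_mul, PadicInt.coe_one]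
      rw [mul_sub, h3, Units.val_mul, PadicInt.coe_mul, hu']
    · rw [one_mul]
      exact mul_le_of_le_one_left (by positivity) (PadicInt.norm_le_one _)
  have h4 := (h1.padicPow (K := K) (by omega) (hχ.norm_lt i)).const_mul (χ i (u 0) : K)
  refine ⟨‖(χ i (u 0) : K)‖ * 1, ?_⟩
  convert h4 using 2 with x
  have hdvd : (p : ℤ_[p]) ^ m ∣
      (((u 0)⁻¹ * u fun j => (p : ℤ_[p]) ^ M * x j : ℤ_[p]ˣ) : ℤ_[p]) - 1 := by
    refine (pow_dvd_pow _ (by omega : m ≤ M)).trans ?_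
    rw [← Ideal.mem_span_singleton, ← PadicInt.norm_le_pow_iff_mem_span_pow]
    have := h1.norm_le x
    rw [← PadicInt.coe_one, ← PadicInt.coe_sub, PadicInt.padic_norm_e_of_padicInt] at this
    simpa using this
  rw [← hm _ hdvd, ← Units.val_mul, ← map_mul, mul_inv_cancel_left]

end Characters

/-! ### Equivariant functions along analytic families of matrices. -/

section EquivariantFunctions

open integralAnalytic

variable {p n : ℕ} [Fact p.Prime] {w : Equiv.Perm (Fin n)} {σ : Type*}

/-- Eliminate once over the function ring, then specialize at each point x. The data `y` and `β`
depend only on the family `M`, so the factors of f are visibly analytic in x. -/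
theorem exists_analytic_decomposition (w : Equiv.Perm (Fin n))
    (M : Matrix (Fin n) (Fin n) (integralAnalytic p σ))
    (h0 : ∀ i j, i < j → (p : integralAnalytic p σ) ∣ M i j) (h1 : ∀ i, IsUnit (M i i)) :
    ∃ (y : WeylIdx w → integralAnalytic p σ) (β : Fin n → (integralAnalytic p σ)ˣ),
      (∀ i, (p : integralAnalytic p σ) ∣ β i - M (w i) (w i)) ∧
      ∀ {K : Type*} [NormedField K] {χ : Fin n → (ℤ_[p]ˣ →* Kˣ)} {f : iwahori p n → K},
      (∀ (g : iwahori p n) (b : weylBorel p n w),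
        f (g * Subgroup.inclusion inf_le_left b) = (weylChar χ w b⁻¹ : Kˣ) * f g) →
      ∀ (x : σ → ℤ_[p]) (g : iwahori p n), (∀ i j, g.1 i j = evalAt x (M i j)) →
      f g = (∏ i, (χ i (Units.map (evalAt x).toMonoidHom (β i)⁻¹) : K)) *
        f (weylPoint w fun q => evalAt x (y q)) := by
  obtain ⟨y, B, hB, hB0, hB1⟩ := exists_unipMatrix_mul_upper w isUnit_one_add_mul M h0 h1
  have hBu : ∀ i, IsUnit (B i i) := fun i => by
    obtain ⟨a, ha⟩ := hB1 i
    have := isUnit_add_mul isUnit_one_add_mul (h1 (w i)) a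
    rwa [← ha, add_sub_cancel] at this
  choose β hβ using hBu
  refine ⟨y, β, fun i => by rw [hβ]; exact hB1 i, fun {K} _ χ f hf x g hg => ?_⟩
  rw [apply_eq_of_decomposition hf (y := fun q => evalAt x (y q)) (B := (evalAt x).mapMatrix B)
    (β := fun i => Units.map (evalAt x).toMonoidHom (β i))]
  · simp only [map_inv]
  · have := congrArg (evalAt x).mapMatrix hB
    rw [map_mul] at this
    convert this using 1
    · congr 1
      rw [weylMat_eq_unipMatrix, ← map_natCast (evalAt x), ← unipMatrix_map]
      rfl
    · ext i j
      exact hg _ _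
  · intro i j hij
    simp [hB0 i j hij]
  · intro i
    change evalAt x (β i).1 = _
    rw [hβ]
    rfl

variable {K : Type*} [NormedField K] [NormedAlgebra ℚ_[p] K] [CompleteSpace K]
  [IsUltrametricDist K] {χ : Fin n → (ℤ_[p]ˣ →* Kˣ)} {c : Fin n → K}

/-- An equivariant function with analytic restriction to `w U w⁻¹ ∩ B` is locally analytic. -/
theorem isLocallyAnalytic_of_equivariant (hχ : IsAnalyticCharacter p χ c) {f : iwahori p n → K}
    (hf : ∀ (g : iwahori p n) (b : weylBorel p n w),
      f (g * Subgroup.inclusion inf_le_left b) = (weylChar χ w b⁻¹ : Kˣ) * f g)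
    {r : ℝ} (hr : IsAnalyticLE p K r fun y => f (weylPoint w y)) : IsLocallyAnalytic p K f := by
  intro g
  -- The generic matrix congruent to g modulo p.
  obtain ⟨y, β, -, h⟩ := exists_analytic_decomposition (p := p) w
    (Matrix.of fun i j => const (g.1 i j) + (p : integralAnalytic p _) * coord (i, j))
    (fun i j hij => by
      obtain ⟨a, ha⟩ := (mem_iwahori p n).1 g.2 i j hij
      refine dvd_add ⟨const a, ?_⟩ (dvd_mul_right _ _)
      exact Subtype.ext (funext fun x => ha))
    (fun i => isUnit_add_mul isUnit_one_add_mul (by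
      obtain ⟨u, hu⟩ := isUnit_iwahori_diag g i
      refine IsUnit.of_mul_eq_one (const (u⁻¹ : ℤ_[p]ˣ)) (Subtype.ext (funext fun x => ?_))
      change g.1 i i * (u⁻¹ : ℤ_[p]ˣ) = 1
      rw [← hu, Units.mul_inv]) _)
  choose M₀ hM₀ using fun i => hχ.exists_isAnalyticLE_scale i (β i)⁻¹
  set M := Finset.univ.sup M₀ with hM
  choose R hR using fun i => hM₀ i M (Finset.le_sup (Finset.mem_univ i))
  have h1 := (IsAnalyticLE.prod fun i (_ : i ∈ Finset.univ) => hR i).mul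
    (hr.comp (y := fun q (x : Fin n × Fin n → ℤ_[p]) =>
      evalAt (fun j => (p : ℤ_[p]) ^ M * x j) (y q)) fun q =>
      (integralAnalytic.isAnalyticLE (y q) K).comp (y := fun j x => (p : ℤ_[p]) ^ M * x j) fun j =>
        integralAnalytic.isAnalyticLE (const ((p : ℤ_[p]) ^ M) * coord j) K)
  -- One factor p comes from the generic matrix, the other p^M from shrinking the ball for all
  -- characters at once.
  refine ⟨M + 1, _, h1.isGloballyAnalytic, fun g' x hx => ?_⟩
  refine h hf (fun j => (p : ℤ_[p]) ^ M * x j) g' fun i j => ?_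
  rw [hx, Matrix.of_apply, map_add, map_mul, map_natCast, pow_succ', mul_assoc]
  rfl

end EquivariantFunctions

/-! ### The generic element of G and its quotient by a generic unipotent matrix. -/

section LDU

variable {R S : Type*} [CommRing R] [CommRing S] {n : ℕ}

/-- The product of a lower unipotent, a diagonal and an upper unipotent matrix, where the diagonal
and the upper entries are given up to a factor `π`. -/
def lduMatrix (π : R) (x : Fin n × Fin n → R) : Matrix (Fin n) (Fin n) R :=
  (Matrix.of fun i j => if j < i then x (i, j) else if i = j then 1 else 0) *
    Matrix.diagonal (fun i => 1 + π * x (i, i)) *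
    Matrix.of fun i j => if i < j then π * x (i, j) else if i = j then 1 else 0

theorem lduMatrix_map (e : R →+* S) (π : R) (x : Fin n × Fin n → R) :
    e.mapMatrix (lduMatrix π x) = lduMatrix (e π) fun q => e (x q) := by
  rw [lduMatrix, map_mul, map_mul, lduMatrix]
  congr 1
  · congr 1
    · ext i j
      simp only [RingHom.mapMatrix_apply, Matrix.map_apply, Matrix.of_apply]
      split_ifs <;> simp
    · ext i j
      simp only [RingHom.mapMatrix_apply, Matrix.map_apply, Matrix.diagonal_apply]
      split_ifs <;> simp
  · ext i j
    simp only [RingHom.mapMatrix_apply, Matrix.map_apply, Matrix.of_apply]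
    split_ifs <;> simp

theorem isUnit_det_lduMatrix {π : R} (hπ : ∀ a, IsUnit (1 + π * a)) (x : Fin n × Fin n → R) :
    IsUnit (lduMatrix π x).det := by
  rw [lduMatrix, Matrix.det_mul, Matrix.det_mul, Matrix.det_diagonal,
    Matrix.det_of_isLowerTriangular, Matrix.det_of_isUpperTriangular]
  · simpa using fun i => hπ _
  · intro i j hij
    have hij' : j < i := by simpa using hij
    simp [hij'.not_gt, hij'.ne']
  · intro i j hij
    have hij' : i < j := by simpa using hij
    simp [hij'.not_gt, hij'.ne]

theorem lduMatrix_zero (x : Fin n × Fin n → R) : lduMatrix 0 x =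
    Matrix.of fun i j => if j < i then x (i, j) else if i = j then 1 else 0 := by
  have h1 : (Matrix.diagonal fun i => 1 + 0 * x (i, i)) = (1 : Matrix (Fin n) (Fin n) R) := by
    simp
  have h2 : (Matrix.of fun i j => if i < j then 0 * x (i, j) else if i = j then 1 else 0) =
      (1 : Matrix (Fin n) (Fin n) R) := by
    ext i j
    simp [Matrix.one_apply]
    intro h1 h2
    exact absurd h2 h1.ne
  rw [lduMatrix, h1, h2, mul_one, mul_one]

theorem det_unipMatrix (w : Equiv.Perm (Fin n)) (π : R) (x : WeylIdx w → R) :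
    (unipMatrix w π x).det = 1 := by
  rw [← Matrix.det_submatrix_equiv_self w, Matrix.det_of_isLowerTriangular]
  · refine Finset.prod_eq_one fun i _ => ?_
    simp [unipMatrix]
  · intro i j hij
    have hij' : i < j := by simpa using hij
    simp [unipMatrix, hij'.not_gt, hij'.ne]

/-- The inverse of the `LDU` matrix times a unipotent matrix, as an element of `GL_n`. -/
theorem exists_ldu_inv_mul_unip {π : R} (hπ : ∀ a, IsUnit (1 + π * a)) (w : Equiv.Perm (Fin n))
    (x : Fin n × Fin n → R) (y : WeylIdx w → R) :
    ∃ N W z : GL (Fin n) R, N.1 = lduMatrix π x ∧ W.1 = unipMatrix w π y ∧ z = N⁻¹ * W ∧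
      (∀ i j, i < j → π ∣ z i j) ∧ ∀ i, π ∣ z i i - 1 := by
  set N : GL (Fin n) R := GeneralLinearGroup.mk'' _ (isUnit_det_lduMatrix hπ x) with hN
  set W : GL (Fin n) R := GeneralLinearGroup.mk'' (unipMatrix w π y)
    (by rw [det_unipMatrix]; exact isUnit_one) with hW
  refine ⟨N, W, N⁻¹ * W, rfl, rfl, rfl, ?_⟩
  -- Over R/π both matrices lose their entries above the diagonal and become lower unipotent, and
  -- the lower unipotent matrices form a group.
  set q := Ideal.Quotient.mk (Ideal.span {π}) with hq
  have hqπ : q π = 0 := Ideal.Quotient.eq_zero_iff_mem.2 (Ideal.mem_span_singleton_self π)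
  have hNq : GeneralLinearGroup.map q N ∈ lowerUnip n _ := by
    have e : (GeneralLinearGroup.map q N).1 = lduMatrix 0 fun t => q (x t) := by
      rw [← hqπ, ← lduMatrix_map]
      rfl
    rw [lduMatrix_zero] at e
    refine ⟨fun i j hij => ?_, fun i => ?_⟩
    · have hij' : i < j := by simpa using hij
      rw [e]
      simp [hij'.not_gt, hij'.ne]
    · rw [e]
      simp
  have hWq : GeneralLinearGroup.map q W ∈ lowerUnip n _ := by
    have e : (GeneralLinearGroup.map q W).1 = unipMatrix w 0 fun t => q (y t) := by
      rw [← hqπ, ← unipMatrix_map]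
      rfl
    refine ⟨fun i j hij => ?_, fun i => ?_⟩
    · have hij' : i < j := by simpa using hij
      rw [e]
      simp [unipMatrix, hij', hij'.ne]
    · rw [e]
      simp [unipMatrix]
  have hz : GeneralLinearGroup.map q (N⁻¹ * W) ∈ lowerUnip n _ := by
    rw [map_mul, map_inv]
    exact mul_mem (inv_mem hNq) hWq
  refine ⟨fun i j hij => ?_, fun i => ?_⟩
  · rw [← Ideal.mem_span_singleton, ← Ideal.Quotient.eq_zero_iff_mem]
    exact hz.1 (by simpa using hij)
  · rw [← Ideal.mem_span_singleton, ← Ideal.Quotient.eq_zero_iff_mem, map_sub, map_one, sub_eq_zero]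
    exact hz.2 i

end LDU

/-! ### Joint analyticity of translates. -/

section Translation

open integralAnalytic

variable {p n : ℕ} [Fact p.Prime] {w : Equiv.Perm (Fin n)}
  {K : Type*} [NormedField K] [NormedAlgebra ℚ_[p] K] [CompleteSpace K]
  [IsUltrametricDist K] {χ : Fin n → (ℤ_[p]ˣ →* Kˣ)} {c : Fin n → K}

/-- Joint analyticity of the translates of an equivariant function. -/
theorem isAnalyticLE_translate (hχ : IsAnalyticCharacter p χ c) (hp : n + 1 < p)
    {f : iwahori p n → K} (hf : ∀ (g : iwahori p n) (b : weylBorel p n w),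
      f (g * Subgroup.inclusion inf_le_left b) = (weylChar χ w b⁻¹ : Kˣ) * f g)
    {r : ℝ} (hr : IsAnalyticLE p K r fun y => f (weylPoint w y)) :
    IsAnalyticLE p K r fun x : (Fin n × Fin n) ⊕ WeylIdx w → ℤ_[p] =>
      translate (proIwahoriChart p n (x ∘ Sum.inl)) f (weylPoint w (x ∘ Sum.inr)) := by
  -- `N` is the generic element of G and `W` the generic point of wUw⁻¹ ∩ B, in independent
  -- variables; `z` is the generic argument h⁻¹u of the translated function.
  obtain ⟨N, W, z, hN, hW, hz, hz0, hz1⟩ := exists_ldu_inv_mul_unip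
    (isUnit_one_add_mul (p := p) (σ := (Fin n × Fin n) ⊕ WeylIdx w)) w
    (fun q => coord (Sum.inl q)) (fun q => coord (Sum.inr q))
  obtain ⟨y, β, hβ, h⟩ := exists_analytic_decomposition (p := p) w z.1 hz0 fun i => by
    obtain ⟨a, ha⟩ := hz1 i
    rw [← add_sub_cancel 1 (z i i), ha]
    exact isUnit_one_add_mul a
  -- β_i ≡ z_{w i, w i} ≡ 1 modulo p, hence the same for the inverse. Each character factor then has
  -- norm at most 1, and the bound `r` for f survives.
  have hβ' : ∀ i, (p : integralAnalytic p ((Fin n × Fin n) ⊕ WeylIdx w)) ∣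
      ((β i)⁻¹ : Units _) - 1 := by
    intro i
    have h1 := (dvd_add (hβ i) (hz1 (w i))).mul_right (-((β i)⁻¹ : Units _))
    rw [sub_add_sub_cancel] at h1
    convert h1 using 1
    linear_combination (β i).mul_inv
  have h1 := (IsAnalyticLE.prod fun i (_ : i ∈ Finset.univ) =>
      hχ.isAnalyticLE hp i (hβ' i)).mul
    (hr.comp fun q => integralAnalytic.isAnalyticLE (y q) K)
  rw [Finset.prod_const_one, one_mul] at h1
  convert h1 using 2 with x
  refine h hf x _ fun i j => ?_
  have hNx : GeneralLinearGroup.map (evalAt x) N = (proIwahoriChart p n (x ∘ Sum.inl)).1 := by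
    refine Units.ext ?_
    change (evalAt x).mapMatrix N.1 = _
    rw [hN, lduMatrix_map, map_natCast]
    rfl
  have hWx : GeneralLinearGroup.map (evalAt x) W = (weylPoint w (x ∘ Sum.inr) : iwahori p n).1 := by
    refine Units.ext ?_
    change (evalAt x).mapMatrix W.1 = _
    rw [hW, unipMatrix_map, map_natCast]
    rfl
  have hzx : GeneralLinearGroup.map (evalAt x) z =
      (proIwahoriChart p n (x ∘ Sum.inl)).1⁻¹ * (weylPoint w (x ∘ Sum.inr) : iwahori p n).1 := by
    rw [hz, map_mul, map_inv, hNx, hWx]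
  exact (congrArg (fun g : GL (Fin n) ℤ_[p] => g i j) hzx).symm

end Translation

theorem translate_one {p n : ℕ} [Fact p.Prime] {K : Type*} (f : iwahori p n → K) :
    translate 1 f = f :=
  funext fun g => by rw [translate, map_one, inv_one, one_mul]

theorem translate_mul {p n : ℕ} [Fact p.Prime] {K : Type*} (h h' : proIwahori p n)
    (f : iwahori p n → K) : translate (h * h') f = translate h (translate h' f) :=
  funext fun g => by rw [translate, translate, translate, map_mul, _root_.mul_inv_rev, mul_assoc]

/-! ### Extension from wUw⁻¹ ∩ B, the restriction isomorphism and the representation. -/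

section Extension

variable {p n : ℕ} [Fact p.Prime] {w : Equiv.Perm (Fin n)}
  {K : Type*} [NormedField K] {χ : Fin n → (ℤ_[p]ˣ →* Kˣ)}

/-- The equivariant extension to `B` of a function on `w U w⁻¹ ∩ B`. -/
noncomputable def equivariantExtension (χ : Fin n → (ℤ_[p]ˣ →* Kˣ)) (w : Equiv.Perm (Fin n))
    (F : (WeylIdx w → ℤ_[p]) → K) (g : iwahori p n) : K :=
  (weylChar χ w (exists_weylPoint_mul w g).choose_spec.choose⁻¹ : Kˣ) *
    F (exists_weylPoint_mul w g).choose

/-- The factorization chosen in the definition is the given one, by uniqueness. -/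
theorem equivariantExtension_apply (F : (WeylIdx w → ℤ_[p]) → K) (y : WeylIdx w → ℤ_[p])
    (b : weylBorel p n w) :
    equivariantExtension χ w F (weylPoint w y * Subgroup.inclusion inf_le_left b) =
      (weylChar χ w b⁻¹ : Kˣ) * F y := by
  have key : ∀ (y' : WeylIdx w → ℤ_[p]) (b' : weylBorel p n w),
      weylPoint w y * Subgroup.inclusion inf_le_left b =
        weylPoint w y' * Subgroup.inclusion inf_le_left b' →
      ((weylChar χ w b'⁻¹ : Kˣ) : K) * F y' = (weylChar χ w b⁻¹ : Kˣ) * F y := by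
    intro y' b' h
    obtain ⟨rfl, rfl⟩ := weylPoint_mul_inj h
    rfl
  exact key _ _ (exists_weylPoint_mul w _).choose_spec.choose_spec

theorem equivariantExtension_weylPoint (F : (WeylIdx w → ℤ_[p]) → K) (y : WeylIdx w → ℤ_[p]) :
    equivariantExtension χ w F (weylPoint w y) = F y := by
  have h := equivariantExtension_apply (χ := χ) F y 1
  rwa [inv_one, map_one, Units.val_one, one_mul, show (weylPoint w y : iwahori p n) *
    Subgroup.inclusion inf_le_left (1 : weylBorel p n w) = weylPoint w y from mul_one _] at h

theorem equivariantExtension_mul (F : (WeylIdx w → ℤ_[p]) → K) (g : iwahori p n)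
    (b : weylBorel p n w) :
    equivariantExtension χ w F (g * Subgroup.inclusion inf_le_left b) =
      (weylChar χ w b⁻¹ : Kˣ) * equivariantExtension χ w F g := by
  obtain ⟨y, b', rfl⟩ := exists_weylPoint_mul w g
  rw [show (weylPoint w y : iwahori p n) * Subgroup.inclusion inf_le_left b' *
    Subgroup.inclusion inf_le_left b = weylPoint w y * Subgroup.inclusion inf_le_left (b' * b) from
    mul_assoc _ _ _, equivariantExtension_apply, equivariantExtension_apply, _root_.mul_inv_rev,
    map_mul, Units.val_mul, mul_assoc]

theorem eq_of_equivariant {f f' : iwahori p n → K}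
    (hf : ∀ (g : iwahori p n) (b : weylBorel p n w),
      f (g * Subgroup.inclusion inf_le_left b) = (weylChar χ w b⁻¹ : Kˣ) * f g)
    (hf' : ∀ (g : iwahori p n) (b : weylBorel p n w),
      f' (g * Subgroup.inclusion inf_le_left b) = (weylChar χ w b⁻¹ : Kˣ) * f' g)
    (h : ∀ y, f (weylPoint w y) = f' (weylPoint w y)) : f = f' := by
  funext g
  obtain ⟨y, b, rfl⟩ := exists_weylPoint_mul w g
  rw [hf, hf', h]

variable [NormedAlgebra ℚ_[p] K] [CompleteSpace K] [IsUltrametricDist K] {c : Fin n → K}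

/-- Local analyticity on B need not be checked separately; both the extension map and the stability
under translation rest on this. -/
theorem mem_indGlob (hχ : IsAnalyticCharacter p χ c) {f : iwahori p n → K}
    (hf : ∀ (g : iwahori p n) (b : weylBorel p n w),
      f (g * Subgroup.inclusion inf_le_left b) = (weylChar χ w b⁻¹ : Kˣ) * f g)
    {r : ℝ} (hr : IsAnalyticLE p K r fun y => f (weylPoint w y)) : f ∈ indGlob χ w :=
  ⟨⟨isLocallyAnalytic_of_equivariant hχ hf hr, hf⟩, hr.isGloballyAnalytic⟩

/-- Extension by equivariance, from the Tate algebra to the induced representation. -/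
noncomputable def extensionMap (hχ : IsAnalyticCharacter p χ c) (w : Equiv.Perm (Fin n)) :
    TateSpace K (WeylIdx w) →ₗ[K] indGlob χ w where
  toFun a := ⟨equivariantExtension χ w (a.eval p), mem_indGlob hχ (equivariantExtension_mul _)
    (r := ‖a‖) (by simpa only [equivariantExtension_weylPoint] using a.isAnalyticLE_eval)⟩
  map_add' a b := Subtype.ext <| funext fun g =>
    (congrArg _ (TateSpace.eval_add a b _)).trans (mul_add _ _ _)
  map_smul' t a := Subtype.ext <| funext fun g =>
    (congrArg _ (TateSpace.eval_smul t a _)).trans (mul_left_comm _ _ _)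

theorem extensionMap_weylPoint (hχ : IsAnalyticCharacter p χ c) (a : TateSpace K (WeylIdx w))
    (y : WeylIdx w → ℤ_[p]) : (extensionMap hχ w a).1 (weylPoint w y) = a.eval p y :=
  equivariantExtension_weylPoint _ y

theorem extensionMap_bijective (hχ : IsAnalyticCharacter p χ c) (w : Equiv.Perm (Fin n)) :
    Function.Bijective (extensionMap hχ w) := by
  constructor
  · intro a b hab
    refine TateSpace.eval_injective (p := p) (funext fun y => ?_)
    rw [← extensionMap_weylPoint hχ, hab, extensionMap_weylPoint]
  · intro f
    obtain ⟨r, hr⟩ := f.2.2.exists_isAnalyticLE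
    obtain ⟨a, -, ha⟩ := TateSpace.exists_hasSum hr
    refine ⟨a, Subtype.ext (eq_of_equivariant (extensionMap hχ w a).2.1.2 f.2.1.2 fun y => ?_)⟩
    rw [extensionMap_weylPoint]
    exact (a.hasSum_eval y).unique (ha y)

/-- Restriction to `w U w⁻¹ ∩ B`. -/
noncomputable def restrictionEquiv (hχ : IsAnalyticCharacter p χ c) (w : Equiv.Perm (Fin n)) :
    indGlob χ w ≃ₗ[K] TateSpace K (WeylIdx w) :=
  (LinearEquiv.ofBijective _ (extensionMap_bijective hχ w)).symm

theorem eval_restrictionEquiv (hχ : IsAnalyticCharacter p χ c) (f : indGlob χ w)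
    (y : WeylIdx w → ℤ_[p]) : (restrictionEquiv hχ w f).eval p y = f.1 (weylPoint w y) := by
  rw [← extensionMap_weylPoint hχ]
  exact congrArg (fun f : indGlob χ w => f.1 (weylPoint w y))
    ((LinearEquiv.ofBijective _ (extensionMap_bijective hχ w)).apply_symm_apply f)

theorem isAnalyticLE_apply_weylPoint (hχ : IsAnalyticCharacter p χ c) (f : indGlob χ w) :
    IsAnalyticLE p K ‖restrictionEquiv hχ w f‖ fun y => f.1 (weylPoint w y) := by
  simpa only [← eval_restrictionEquiv hχ] using (restrictionEquiv hχ w f).isAnalyticLE_eval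

omit [NormedAlgebra ℚ_[p] K] [CompleteSpace K] [IsUltrametricDist K] in
theorem translate_equivariant {f : iwahori p n → K}
    (hf : ∀ (g : iwahori p n) (b : weylBorel p n w),
      f (g * Subgroup.inclusion inf_le_left b) = (weylChar χ w b⁻¹ : Kˣ) * f g)
    (h : proIwahori p n) (g : iwahori p n) (b : weylBorel p n w) :
    translate h f (g * Subgroup.inclusion inf_le_left b) =
      (weylChar χ w b⁻¹ : Kˣ) * translate h f g := by
  rw [translate, translate, ← mul_assoc, hf]

/-- Substituting the constant coordinates of h into the jointly analytic function does not increase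
the bound. -/
theorem isAnalyticLE_translate_weylPoint (hχ : IsAnalyticCharacter p χ c) (hp : n + 1 < p)
    (h : proIwahori p n) (f : indGlob χ w) :
    IsAnalyticLE p K ‖restrictionEquiv hχ w f‖ fun y => translate h f.1 (weylPoint w y) := by
  obtain ⟨x, rfl⟩ := (proIwahoriChart p n).surjective h
  have h1 := isAnalyticLE_translate hχ hp f.2.1.2 (isAnalyticLE_apply_weylPoint hχ f)
  refine h1.comp (y := fun i y => Sum.elim x y i) fun i => ?_
  rcases i with i | i
  · exact integralAnalytic.isAnalyticLE (integralAnalytic.const (x i)) K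
  · exact integralAnalytic.isAnalyticLE (integralAnalytic.coord i) K

/-- Translation on the induced representation. -/
noncomputable def translation (hχ : IsAnalyticCharacter p χ c) (hp : n + 1 < p)
    (w : Equiv.Perm (Fin n)) : proIwahori p n →* Module.End K (indGlob χ w) where
  toFun h :=
    { toFun := fun f => ⟨translate h f.1, mem_indGlob hχ (translate_equivariant f.2.1.2 h)
        (isAnalyticLE_translate_weylPoint hχ hp h f)⟩
      map_add' := fun _ _ => rfl
      map_smul' := fun _ _ => rfl }
  map_one' := LinearMap.ext fun f => Subtype.ext (translate_one f.1)
  map_mul' h h' := LinearMap.ext fun f => Subtype.ext (translate_mul h h' f.1)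

/-- By uniqueness of coefficients, any power series representing the translate computes its Tate
norm. -/
theorem norm_restrictionEquiv_translation_le (hχ : IsAnalyticCharacter p χ c) (hp : n + 1 < p)
    (h : proIwahori p n) (f : indGlob χ w) :
    ‖restrictionEquiv hχ w (translation hχ hp w h f)‖ ≤ ‖restrictionEquiv hχ w f‖ := by
  obtain ⟨a, han, ha⟩ := TateSpace.exists_hasSum (isAnalyticLE_translate_weylPoint hχ hp h f)
  convert han
  refine TateSpace.eval_injective (p := p) (funext fun y => ?_)
  rw [eval_restrictionEquiv]
  exact ((a.hasSum_eval y).unique (ha y)).symm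

/-- The representation of `G` on the Tate algebra. -/
noncomputable def tateRep (hχ : IsAnalyticCharacter p χ c) (hp : n + 1 < p)
    (w : Equiv.Perm (Fin n)) :
    proIwahori p n →* (TateSpace K (WeylIdx w) →L[K] TateSpace K (WeylIdx w)) where
  toFun h := LinearMap.mkContinuous
    ((restrictionEquiv hχ w).toLinearMap ∘ₗ translation hχ hp w h ∘ₗ
      (restrictionEquiv hχ w).symm.toLinearMap) 1 fun a => by
    simpa using norm_restrictionEquiv_translation_le hχ hp h ((restrictionEquiv hχ w).symm a)
  map_one' := ContinuousLinearMap.ext fun a => by simp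
  map_mul' h h' := ContinuousLinearMap.ext fun a => by simp

theorem tateRep_apply (hχ : IsAnalyticCharacter p χ c) (hp : n + 1 < p) (h : proIwahori p n)
    (f : indGlob χ w) : tateRep hχ hp w h (restrictionEquiv hχ w f) =
      restrictionEquiv hχ w (translation hχ hp w h f) := by
  simp [tateRep]

theorem isGloballyAnalyticRep_tateRep (hχ : IsAnalyticCharacter p χ c) (hp : n + 1 < p)
    (w : Equiv.Perm (Fin n)) : IsGloballyAnalyticRep p K (tateRep hχ hp w) := by
  intro a
  obtain ⟨f, rfl⟩ := (restrictionEquiv hχ w).surjective a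
  refine (TateSpace.isGloballyAnalytic_of_joint
    (isAnalyticLE_translate hχ hp f.2.1.2 (isAnalyticLE_apply_weylPoint hχ f)) fun x y => ?_).1
  rw [tateRep_apply, eval_restrictionEquiv]
  rfl

end Extension

end WeylInd

theorem mainTheorem5 (p : ℕ) [Fact p.Prime] (n : ℕ) (hp : n + 1 < p)
    (K : Type*) [NormedField K] [NormedAlgebra ℚ_[p] K] [FiniteDimensional ℚ_[p] K]
    (χ : Fin n → (ℤ_[p]ˣ →* Kˣ)) (c : Fin n → K) (hχ : WeylInd.IsAnalyticCharacter p χ c)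
    (w : Equiv.Perm (Fin n)) :
    ∃ Φ : WeylInd.indGlob χ w ≃ₗ[K] WeylInd.TateSpace K (WeylInd.WeylIdx w),
      (∀ (f : WeylInd.indGlob χ w) (y : WeylInd.WeylIdx w → ℤ_[p]),
        HasSum (fun k => WeylInd.monomialVal p K k y * (Φ f).coeff k)
          (f.1 (WeylInd.weylPoint w y))) ∧
      ∃ ρ : WeylInd.proIwahori p n →*
          (WeylInd.TateSpace K (WeylInd.WeylIdx w) →L[K] WeylInd.TateSpace K (WeylInd.WeylIdx w)),
        (∀ (h : WeylInd.proIwahori p n) (f : WeylInd.indGlob χ w),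
          (Φ.symm (ρ h (Φ f))).1 = WeylInd.translate h f.1) ∧
        WeylInd.IsGloballyAnalyticRep p K ρ := by
  have : CompleteSpace K := FiniteDimensional.complete ℚ_[p] K
  -- A normed field is ultrametric as soon as its natural numbers have norm at most 1, which K
  -- inherits from ℚ_p.
  have : IsUltrametricDist K :=
    IsUltrametricDist.isUltrametricDist_of_forall_norm_natCast_le_one fun m => by
      rw [← map_natCast (algebraMap ℚ_[p] K), norm_algebraMap']
      exact IsUltrametricDist.norm_natCast_le_one _ m
  refine ⟨WeylInd.restrictionEquiv hχ w, fun f y => ?_, WeylInd.tateRep hχ hp w, fun h f => ?_,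
    WeylInd.isGloballyAnalyticRep_tateRep hχ hp w⟩
  · rw [← WeylInd.eval_restrictionEquiv hχ]
    exact WeylInd.TateSpace.hasSum_eval _ y
  · rw [WeylInd.tateRep_apply, LinearEquiv.symm_apply_apply]
    rfl
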